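/- For every $n$ let $U_n$ be a Haar unitary random matrix of size $n\times n$, that is, a random variable with values in the unitary group $\mathcal U(n)$ whose law is the normalized Haar measure (the matrices $U_n$ may be defined on different probability spaces). Let $l\ge 0$ be an integer and let $Z_1,\dots,Z_l$ be independent standard complex normal random variables, that is, for each $i$ the variables $\operatorname{Re} Z_i$ and $\operatorname{Im} Z_i$ are independent and $N(0,1/2)$-distributed. Then: 1. All joint moments of $(\operatorname{Tr} U_n,\operatorname{Tr} U_n^2,\dots,\operatorname{Tr} U_n^l)$ and of $(Z_1,\sqrt2 Z_2,\dots,\sqrt l Z_l)$ exist, and for all non-negative integers $a_1,\dots,a_l,b_1,\dots,b_l$, $$\lim_{n\to\infty} E\Big(\prod_{i=1}^l (\operatorname{Tr} U_n^i)^{a_i}\,\overline{(\operatorname{Tr} U_n^i)}^{\,b_i}\Big)=E\Big(\prod_{i=1}^l (\sqrt i Z_i)^{a_i}\,\overline{(\sqrt i Z_i)}^{\,b_i}\Big)=\prod_{i=1}^l \delta_{a_i b_i}\,a_i!\,i^{a_i}.$$ 2. The random vectors $(\operatorname{Tr} U_n,\operatorname{Tr} U_n^2,\dots,\operatorname{Tr}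 U_n^l)$ converge in distribution, as $n\to\infty$, to $(Z_1,\sqrt2 Z_2,\dots,\sqrt l Z_l)$, whose coordinates are independent. 3. Consequently $\operatorname{Tr} U_n,\operatorname{Tr} U_n^2,\dots,\operatorname{Tr} U_n^l$ are asymptotically independent: for all bounded continuous functions $f_1,\dots,f_l:\mathbb C\to\mathbb R$, $$\lim_{n\to\infty}\Big(E\Big(\prod_{i=1}^l f_i(\operatorname{Tr} U_n^i)\Big)-\prod_{i=1}^l E\big(f_i(\operatorname{Tr} U_n^i)\big)\Big)=0.$$ -/

import Mathlib

open MeasureTheory ProbabilityTheory Filter Topology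
open scoped BoundedContinuousFunction NNReal

noncomputable section

namespace HaarUnitary

/-- The unitary group `U(n)` carries its Borel σ-algebra. -/
instance instMeasurableSpaceUnitaryGroup (n : ℕ) :
    MeasurableSpace (Matrix.unitaryGroup (Fin n) ℂ) :=
  borel _

instance instBorelSpaceUnitaryGroup (n : ℕ) : BorelSpace (Matrix.unitaryGroup (Fin n) ℂ) :=
  ⟨rfl⟩

instance instCompactSpaceUnitaryGroup (n : ℕ) :
    CompactSpace (Matrix.unitaryGroup (Fin n) ℂ) := by
  refine isCompact_iff_compactSpace.mp ?_
  have hK : IsCompact (Set.univ.pi fun _ : Fin n => Set.univ.pi fun _ : Fin n =>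
      Metric.closedBall (0 : ℂ) 1) :=
    isCompact_univ_pi fun _ => isCompact_univ_pi fun _ => isCompact_closedBall 0 1
  have hc : IsClosed ((Matrix.unitaryGroup (Fin n) ℂ : Submonoid _) :
      Set (Matrix (Fin n) (Fin n) ℂ)) := isClosed_unitary
  refine IsCompact.of_isClosed_subset (X := Matrix (Fin n) (Fin n) ℂ) hK hc ?_
  intro A hA i _ j _
  simpa using entry_norm_bound_of_unitary hA i j

/-- The normalized Haar measure on the compact group `U(n)`. -/
def haarUnitaryMeasure (n : ℕ) : Measure (Matrix.unitaryGroup (Fin n) ℂ) :=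
  Measure.haarMeasure ⊤

/-- A standard complex normal variable: the real and imaginary parts are independent and
`N(0, 1/2)`-distributed. -/
structure IsStdComplexNormal {Ω : Type*} [MeasurableSpace Ω] (ξ : Ω → ℂ) (P : Measure Ω) :
    Prop where
  law_re : HasLaw (fun ω => (ξ ω).re) (gaussianReal 0 (1 / 2)) P
  law_im : HasLaw (fun ω => (ξ ω).im) (gaussianReal 0 (1 / 2)) P
  indep : IndepFun (fun ω => (ξ ω).re) (fun ω => (ξ ω).im) P

/-- `Tr (V ^ k)` for a unitary matrix `V`. -/
def powTrace {n : ℕ} (k : ℕ) (V : Matrix.unitaryGroup (Fin n) ℂ) : ℂ :=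
  ((V : Matrix (Fin n) (Fin n) ℂ) ^ k).trace

/-- The monomial `∏ i, (z i) ^ (a i) * conj (z i) ^ (b i)`; its expectation at a random vector
is the joint moment with exponents `a`, `b`. -/
def mixedMonomial {l : ℕ} (a b : Fin l → ℕ) (z : Fin l → ℂ) : ℂ :=
  ∏ i, z i ^ a i * (starRingEnd ℂ) (z i) ^ b i

/-- Asymptotic independence of the coordinates of a sequence of random vectors: expectations of
products of bounded continuous functions of the coordinates asymptotically factorize. -/
def AsymptoticallyIndependent {l : ℕ} {Ω : ℕ → Type*} [∀ n, MeasurableSpace (Ω n)]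
    (P : ∀ n, Measure (Ω n)) (X : ∀ n, Ω n → Fin l → ℂ) : Prop :=
  ∀ f : Fin l → (ℂ →ᵇ ℝ),
    Tendsto (fun n => (∫ ω, ∏ i, f i (X n ω i) ∂(P n)) - ∏ i, ∫ ω, f i (X n ω i) ∂(P n))
      atTop (𝓝 0)

end HaarUnitary

end

/-! Left invariance of Haar measure yields integration by parts on U(n): the derivative of `F (exp
(tA) V)` at `t = 0` has mean zero. Take F to be the entry `(V^k)_{ab}` times a product of power
traces indexed by a multiset s, take `A = E_{ab}`, and sum over a, b. This gives the Schwinger–Dyson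
equation `schwingerDyson`: ∑_{j<k} E[Tr V^j · Tr V^{k-j} · ∏_s] + ∑_{x∈s} x · E[Tr V^{k+x} ·
∏_{s∖x}] = 0. The summand j = 0 is n times E[Tr V^k · ∏_s], and each x = -k produces Tr 1 = n. After
division by n the remaining terms are O(1/n), provided the moments are bounded uniformly in n. So in
the limit Tr V^k is contracted with each factor Tr V^{-k}, with weight k
(`tendsto_integral_ptrProd_cons`). This is Wick's rule for √k Z_k, and induction on the degree gives
the Gaussian moments.

The uniform bounds come from the same equation with s chosen so that j = 0 gives an even absolute
moment. One trace in each other term is bounded by n, and a weighted Young inequality absorbs the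
top-order part.

Gaussian vectors have exponential moments, so Taylor expansion turns convergence of moments into
convergence of characteristic functions, and Lévy's theorem gives convergence in distribution.
Asymptotic independence follows by testing against products of functions of single coordinates. -/

noncomputable section

namespace HaarUnitary

/-! ### Integration by parts for the Haar measure on the unitary group -/

section Gradient

open scoped Matrix.Norms.Operator

variable {n : ℕ}

local notation "𝕌" n => Matrix.unitaryGroup (Fin n) ℂ
local notation "𝕄" n => Matrix (Fin n) (Fin n) ℂ

instance isProbabilityMeasure_haarUnitaryMeasure :
    IsProbabilityMeasure (haarUnitaryMeasure n) :=
  ⟨Measure.haarMeasure_self (K₀ := (⊤ : TopologicalSpace.PositiveCompacts (𝕌 n)))⟩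

instance isMulLeftInvariant_haarUnitaryMeasure :
    (haarUnitaryMeasure n).IsMulLeftInvariant := by
  unfold haarUnitaryMeasure; infer_instance

lemma integrable_of_continuous {F : (𝕌 n) → ℂ} (hF : Continuous F) :
    Integrable F (haarUnitaryMeasure n) := by
  have := (BoundedContinuousFunction.mkOfCompact ⟨F, hF⟩).integrable (haarUnitaryMeasure n)
  exact this

/-- The one-parameter group `t ↦ exp (t A)` of unitary matrices. -/
def expCurve (A : 𝕄 n) (hA : A ∈ skewAdjoint (𝕄 n)) (t : ℝ) : 𝕌 n :=
  ⟨NormedSpace.exp (t • A), by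
    -- Continuity of the star is needed for the norm topology, which unfolds to the entrywise one.
    have : @ContinuousStar (𝕄 n) PseudoMetricSpace.toUniformSpace.toTopologicalSpace _ :=
      instContinuousStarMatrix
    refine NormedSpace.exp_mem_unitary_of_mem_skewAdjoint ?_
    rw [skewAdjoint.mem_iff] at hA ⊢
    rw [star_smul, hA, smul_neg, star_trivial]⟩

lemma expCurve_zero (A : 𝕄 n) (hA : A ∈ skewAdjoint (𝕄 n)) : expCurve A hA 0 = 1 :=
  Subtype.ext (by simp [expCurve])

lemma expCurve_add (A : 𝕄 n) (hA : A ∈ skewAdjoint (𝕄 n)) (s t : ℝ) :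
    expCurve A hA (s + t) = expCurve A hA s * expCurve A hA t := by
  refine Subtype.ext ?_
  simp only [expCurve, add_smul, Submonoid.coe_mul]
  exact NormedSpace.exp_add_of_commute (((Commute.refl A).smul_left s).smul_right t)

lemma hasDerivAt_expCurve (A : 𝕄 n) (hA : A ∈ skewAdjoint (𝕄 n)) :
    HasDerivAt (fun t => (expCurve A hA t : 𝕄 n)) A 0 := by
  have h := hasDerivAt_exp_smul_const (𝕂 := ℝ) A (0 : ℝ)
  rw [zero_smul, NormedSpace.exp_zero, one_mul] at h
  exact h

/-- `F'` is the gradient of `F` along left translations, for the trace pairing. -/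
structure HasGrad (F : (𝕌 n) → ℂ) (F' : (𝕌 n) → 𝕄 n) : Prop where
  cont : Continuous F
  cont' : Continuous F'
  deriv : ∀ A (hA : A ∈ skewAdjoint (𝕄 n)) V,
    HasDerivAt (fun t => F (expCurve A hA t * V)) (A * F' V).trace 0

/-- The group law `exp (sA) = exp ((s - t)A) exp (tA)` reduces time t to time 0 at a translated base
point. -/
lemma HasGrad.hasDerivAt {F : (𝕌 n) → ℂ} {F' : (𝕌 n) → 𝕄 n} (h : HasGrad F F')
    (A) (hA : A ∈ skewAdjoint (𝕄 n)) (V) (t : ℝ) :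
    HasDerivAt (fun t => F (expCurve A hA t * V)) (A * F' (expCurve A hA t * V)).trace t := by
  have h1 := h.deriv A hA (expCurve A hA t * V)
  have h2 : HasDerivAt (fun s : ℝ => s - t) 1 t := (hasDerivAt_id t).sub_const t
  rw [← sub_self t] at h1
  have h3 := HasDerivAt.scomp (h := fun s : ℝ => s - t) t h1 h2
  rw [one_smul] at h3
  refine h3.congr_of_eventuallyEq (Eventually.of_forall fun s => ?_)
  simp [← mul_assoc, ← expCurve_add]

/-- By left invariance the integral of `F (exp (tA) V)` does not depend on t; compactness bounds the
derivative, so one may differentiate under the integral. -/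
lemma HasGrad.integral_skew {F : (𝕌 n) → ℂ} {F' : (𝕌 n) → 𝕄 n} (h : HasGrad F F')
    (A) (hA : A ∈ skewAdjoint (𝕄 n)) :
    ∫ V, (A * F' V).trace ∂haarUnitaryMeasure n = 0 := by
  have hc : Continuous fun V => (A * F' V).trace :=
    (continuous_const.matrix_mul h.cont').matrix_trace
  obtain ⟨C, hC⟩ : ∃ C, ∀ V, ‖(A * F' V).trace‖ ≤ C :=
    ⟨_, fun V => (BoundedContinuousFunction.mkOfCompact ⟨_, hc⟩).norm_coe_le_norm V⟩
  have key := (hasDerivAt_integral_of_dominated_loc_of_deriv_le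
    (μ := haarUnitaryMeasure n) (F := fun (t : ℝ) V => F (expCurve A hA t * V))
    (F' := fun (t : ℝ) V => (A * F' (expCurve A hA t * V)).trace) (x₀ := 0)
    (s := Set.univ) (bound := fun _ => C) univ_mem
    (Eventually.of_forall fun t =>
      (h.cont.comp (continuous_const_mul _)).aestronglyMeasurable)
    (integrable_of_continuous (h.cont.comp (continuous_const_mul _)))
    (hc.comp (continuous_const_mul _)).aestronglyMeasurable
    (Eventually.of_forall fun V t _ => hC _) (integrable_const C)
    (Eventually.of_forall fun V t _ => h.hasDerivAt A hA V t)).2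
  simp only [integral_mul_left_eq_self, expCurve_zero, one_mul] at key
  exact key.unique (hasDerivAt_const _ _)

/-- The gradient of a function has integral zero with respect to the Haar measure. -/
lemma HasGrad.integral_eq_zero {F : (𝕌 n) → ℂ} {F' : (𝕌 n) → 𝕄 n} (h : HasGrad F F')
    (A : 𝕄 n) : ∫ V, (A * F' V).trace ∂haarUnitaryMeasure n = 0 := by
  have hi : ∀ B : 𝕄 n, Integrable (fun V => (B * F' V).trace) (haarUnitaryMeasure n) :=
    fun B => integrable_of_continuous (continuous_const.matrix_mul h.cont').matrix_trace
  -- Every matrix is a complex combination of the two skew-adjoint matrices `A - A*` and `i(A +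
  -- A*)`, and the trace pairing is complex linear in A.
  have h1 : A - star A ∈ skewAdjoint (𝕄 n) := by
    rw [skewAdjoint.mem_iff]; simp
  have h2 : Complex.I • (A + star A) ∈ skewAdjoint (𝕄 n) := by
    rw [skewAdjoint.mem_iff, star_smul, star_add, star_star]; simp [add_comm]
  have e : ∀ V, (A * F' V).trace = (1 / 2 : ℂ) * ((A - star A) * F' V).trace
      - (Complex.I / 2) * (Complex.I • (A + star A) * F' V).trace := by
    intro V
    simp only [sub_mul, add_mul, Matrix.smul_mul, Matrix.trace_smul, Matrix.trace_sub,
      Matrix.trace_add, smul_eq_mul]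
    linear_combination (1 / 2) * ((A * F' V).trace + (star A * F' V).trace) * Complex.I_mul_I
  simp_rw [e]
  rw [integral_sub ((hi _).const_mul _) ((hi _).const_mul _), integral_const_mul,
    integral_const_mul, h.integral_skew _ h1, h.integral_skew _ h2]
  simp

lemma HasGrad.mul {F G : (𝕌 n) → ℂ} {F' G' : (𝕌 n) → 𝕄 n} (hF : HasGrad F F')
    (hG : HasGrad G G') :
    HasGrad (fun V => F V * G V) (fun V => G V • F' V + F V • G' V) where
  cont := hF.cont.mul hG.cont
  cont' := (hG.cont.smul hF.cont').add (hF.cont.smul hG.cont')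
  deriv A hA V := by
    refine ((hF.deriv A hA V).mul (hG.deriv A hA V)).congr_deriv ?_
    simp only [expCurve_zero, one_mul, mul_add, Matrix.mul_smul, Matrix.trace_add,
      Matrix.trace_smul, smul_eq_mul]
    ring

lemma hasGrad_const (c : ℂ) : HasGrad (fun _ : 𝕌 n => c) (fun _ => 0) where
  cont := continuous_const
  cont' := continuous_const
  deriv A hA V := by simpa using hasDerivAt_const (0 : ℝ) c

lemma hasDerivAt_expCurve_mul_pow (A : 𝕄 n) (hA : A ∈ skewAdjoint (𝕄 n)) (V : 𝕌 n) (k : ℕ) :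
    HasDerivAt (fun t => ((expCurve A hA t * V : 𝕌 n) : 𝕄 n) ^ k)
      (∑ j ∈ Finset.range k, (V : 𝕄 n) ^ j * A * (V : 𝕄 n) ^ (k - j)) 0 := by
  have h := ((hasDerivAt_expCurve A hA).mul_const (V : 𝕄 n)).fun_pow' k
  simp only [expCurve_zero, OneMemClass.coe_one, one_mul] at h
  refine h.congr_deriv ?_
  -- The curve has derivative `A V` at 0; the extra V on the right of A turns the exponent `k - 1 -
  -- j` into `k - j`.
  rw [← Finset.sum_range_reflect]
  refine Finset.sum_congr rfl fun j hj => ?_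
  have hj := Finset.mem_range.1 hj
  rw [mul_assoc, mul_assoc, mul_assoc, ← pow_succ', show k.pred - (k - 1 - j) = j by
    rw [Nat.pred_eq_sub_one]; omega, show k - 1 - j + 1 = k - j by omega]

lemma hasDerivAt_trace {f : ℝ → 𝕄 n} {f' : 𝕄 n} {t : ℝ} (h : HasDerivAt f f' t) (B : 𝕄 n) :
    HasDerivAt (fun s => (B * f s).trace) (B * f').trace t := by
  let L : (𝕄 n) →L[ℝ] ℂ := LinearMap.toContinuousLinearMap
    ((Matrix.traceLinearMap (Fin n) ℝ ℂ) ∘ₗ LinearMap.mulLeft ℝ B)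
  exact L.hasFDerivAt.comp_hasDerivAt t h

/-- `Tr (V ^ m)` for an integer `m`. -/
def ptr (m : ℤ) (V : 𝕌 n) : ℂ := ((V ^ m : 𝕌 n) : 𝕄 n).trace

lemma continuous_coe_zpow (m : ℤ) : Continuous fun V : 𝕌 n => ((V ^ m : 𝕌 n) : 𝕄 n) :=
  continuous_subtype_val.comp (continuous_zpow m)

lemma continuous_ptr (m : ℤ) : Continuous (ptr m : (𝕌 n) → ℂ) :=
  (continuous_coe_zpow m).matrix_trace

lemma ptr_natCast (k : ℕ) (V : 𝕌 n) : ptr k V = powTrace k V := by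
  simp [ptr, powTrace]

lemma ptr_zero (V : 𝕌 n) : ptr 0 V = n := by simp [ptr]

lemma ptr_neg (m : ℤ) (V : 𝕌 n) : ptr (-m) V = starRingEnd ℂ (ptr m V) := by
  rw [ptr, ptr, zpow_neg, starRingEnd_apply, ← Matrix.trace_conjTranspose]
  rfl

lemma norm_ptr_le (m : ℤ) (V : 𝕌 n) : ‖ptr m V‖ ≤ n := by
  rw [ptr, Matrix.trace]
  refine (norm_sum_le _ _).trans ?_
  simpa using Finset.sum_le_sum fun i (_ : i ∈ Finset.univ) =>
    entry_norm_bound_of_unitary (V ^ m).2 i i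

/-- For m ≥ 0 cyclicity of the trace makes the Leibniz summands equal. Negative m follows by
conjugation, where `A* = -A` supplies the sign. -/
lemma hasGrad_ptr (m : ℤ) :
    HasGrad (ptr m : (𝕌 n) → ℂ) (fun V => (m : ℂ) • ((V ^ m : 𝕌 n) : 𝕄 n)) where
  cont := continuous_ptr m
  cont' := (continuous_coe_zpow m).const_smul (m : ℂ)
  deriv A hA V := by
    have hn : ∀ k : ℕ, HasDerivAt (fun t => ptr (k : ℤ) (expCurve A hA t * V))
        ((k : ℂ) * (A * (V : 𝕄 n) ^ k).trace) 0 := by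
      intro k
      have := hasDerivAt_trace (hasDerivAt_expCurve_mul_pow A hA V k) 1
      simp only [one_mul] at this
      refine (this.congr_of_eventuallyEq (Eventually.of_forall fun t => ?_)).congr_deriv ?_
      · simp [ptr]
      rw [Matrix.trace_sum, Finset.sum_congr rfl (g := fun _ => (A * (V : 𝕄 n) ^ k).trace)]
      · simp
      · intro j hj
        rw [mul_assoc, Matrix.trace_mul_comm, mul_assoc, ← pow_add,
          Nat.sub_add_cancel (Finset.mem_range.1 hj).le]
    obtain ⟨k, rfl | rfl⟩ := m.eq_nat_or_neg
    · simpa using hn k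
    · simp_rw [ptr_neg]
      have h := (hn k).star
      refine h.congr_deriv ?_
      rw [skewAdjoint.mem_iff] at hA
      rw [star_mul', ← starRingEnd_apply (Matrix.trace _)]
      rw [starRingEnd_apply, ← Matrix.trace_conjTranspose, Matrix.conjTranspose_mul,
        ← Matrix.star_eq_conjTranspose A, hA, zpow_neg, Matrix.mul_smul, Matrix.trace_smul,
        Matrix.trace_mul_comm]
      simp [Matrix.star_eq_conjTranspose]

/-- The entry is `Tr (E_{ba} V^k)`, and cyclicity brings A to the front of each Leibniz term. -/
lemma hasGrad_pow_apply (k : ℕ) (a b : Fin n) :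
    HasGrad (fun V : 𝕌 n => ((V : 𝕄 n) ^ k) a b)
      (fun V => ∑ j ∈ Finset.range k, (V : 𝕄 n) ^ (k - j) * Matrix.single b a 1 *
        (V : 𝕄 n) ^ j) where
  cont := (continuous_subtype_val.pow k).matrix_elem a b
  cont' := continuous_finsetSum _ fun j _ =>
    ((continuous_subtype_val.pow _).matrix_mul continuous_const).matrix_mul
      (continuous_subtype_val.pow _)
  deriv A hA V := by
    have := hasDerivAt_trace (hasDerivAt_expCurve_mul_pow A hA V k) (Matrix.single b a 1)
    refine (this.congr_of_eventuallyEq (Eventually.of_forall fun t => ?_)).congr_deriv ?_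
    · simp [Matrix.trace_single_mul]
    · simp only [Finset.mul_sum, Matrix.trace_sum]
      refine Finset.sum_congr rfl fun j _ => ?_
      rw [← mul_assoc, ← mul_assoc, Matrix.trace_mul_comm, ← mul_assoc, ← mul_assoc,
        Matrix.trace_mul_comm]

end Gradient

/-! ### Schwinger–Dyson equations for products of power traces -/

section SchwingerDyson

variable {n : ℕ}

local notation "𝕌" n => Matrix.unitaryGroup (Fin n) ℂ
local notation "𝕄" n => Matrix (Fin n) (Fin n) ℂ

/-- The product of the traces `Tr (V ^ m)`, where `m` runs over a multiset of integers. -/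
def ptrProd (s : Multiset ℤ) (V : 𝕌 n) : ℂ := (s.map fun m => ptr m V).prod

@[simp] lemma ptrProd_zero (V : 𝕌 n) : ptrProd 0 V = 1 := by simp [ptrProd]

@[simp] lemma ptrProd_cons (m : ℤ) (s : Multiset ℤ) (V : 𝕌 n) :
    ptrProd (m ::ₘ s) V = ptr m V * ptrProd s V := by simp [ptrProd]

lemma ptrProd_add (s t : Multiset ℤ) (V : 𝕌 n) :
    ptrProd (s + t) V = ptrProd s V * ptrProd t V := by simp [ptrProd]

lemma ptrProd_replicate (k : ℕ) (m : ℤ) (V : 𝕌 n) :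
    ptrProd (Multiset.replicate k m) V = ptr m V ^ k := by simp [ptrProd]

lemma continuous_ptrProd (s : Multiset ℤ) : Continuous (ptrProd s : (𝕌 n) → ℂ) := by
  induction s using Multiset.induction with
  | empty => simpa [funext ptrProd_zero] using! continuous_const
  | cons m s ih => simpa [funext (ptrProd_cons m s)] using! (continuous_ptr m).mul ih

lemma ptrProd_erase_cons (m : ℤ) {x : ℤ} {s : Multiset ℤ} (hx : x ∈ s) (V : 𝕌 n) :
    ptrProd ((m ::ₘ s).erase x) V = ptr m V * ptrProd (s.erase x) V := by
  by_cases h : x = m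
  · subst h
    rw [Multiset.erase_cons_head, ← ptrProd_cons, Multiset.cons_erase hx]
  · rw [Multiset.erase_cons_tail _ (Ne.symm h), ptrProd_cons]

lemma hasGrad_ptrProd (s : Multiset ℤ) :
    HasGrad (ptrProd s : (𝕌 n) → ℂ) (fun V => (s.map fun x : ℤ =>
      ((x : ℂ) * ptrProd (s.erase x) V) • ((V ^ x : 𝕌 n) : 𝕄 n)).sum) := by
  induction s using Multiset.induction with
  | empty => simpa [funext ptrProd_zero] using! hasGrad_const (n := n) 1
  | cons m s ih =>
    convert! (hasGrad_ptr m).mul ih using 1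
    · funext V; simp
    · funext V
      rw [Multiset.map_cons, Multiset.sum_cons, Multiset.erase_cons_head, smul_smul,
        Multiset.smul_sum, Multiset.map_map, mul_comm]
      congr 2
      refine Multiset.map_congr rfl fun x hx => ?_
      rw [Function.comp_apply, ptrProd_erase_cons m hx, smul_smul]
      congr 1
      ring

/-- The **Schwinger–Dyson equation** for products of power traces of a Haar unitary. -/
lemma schwingerDyson (k : ℕ) (s : Multiset ℤ) :
    ∑ j ∈ Finset.range k, ∫ V : 𝕌 n, ptr j V * ptr (k - j) V * ptrProd s V
        ∂haarUnitaryMeasure n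
      + ∑ x ∈ s.toFinset, (s.count x : ℂ) * x *
        ∫ V : 𝕌 n, ptr (k + x) V * ptrProd (s.erase x) V ∂haarUnitaryMeasure n = 0 := by
  -- Summing over a, b: where the derivative hits `V^k`, one trace splits into two; where it hits a
  -- trace of the product, that trace merges with `V^k`.
  have h0 := fun a b : Fin n =>
    ((hasGrad_pow_apply k a b).mul (hasGrad_ptrProd s)).integral_eq_zero (Matrix.single a b 1)
  have hi : ∀ a b : Fin n, Integrable (fun V : 𝕌 n => (Matrix.single a b 1 * _ : 𝕄 n).trace)
      (haarUnitaryMeasure n) := fun a b => integrable_of_continuous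
    (continuous_const.matrix_mul
      ((hasGrad_pow_apply k a b).mul (hasGrad_ptrProd s)).cont').matrix_trace
  have h1 := Finset.sum_eq_zero (s := Finset.univ) fun a (_ : a ∈ Finset.univ) =>
    Finset.sum_eq_zero (s := Finset.univ) fun b (_ : b ∈ Finset.univ) => h0 a b
  have h2 : ∀ V : 𝕌 n, ∑ j ∈ Finset.range k, ptr j V * ptr (k - j) V * ptrProd s V
      + ∑ x ∈ s.toFinset, (s.count x : ℂ) * x * (ptr (k + x) V * ptrProd (s.erase x) V)
      = ∑ a, ∑ b, (Matrix.single a b 1 * (ptrProd s V • ∑ j ∈ Finset.range k,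
          (V : 𝕄 n) ^ (k - j) * Matrix.single b a 1 * (V : 𝕄 n) ^ j + ((V : 𝕄 n) ^ k) a b •
          (s.map fun x : ℤ => ((x : ℂ) * ptrProd (s.erase x) V) • ((V ^ x : 𝕌 n) : 𝕄 n)).sum) :
          𝕄 n).trace := by
    intro V
    simp only [mul_add, Matrix.trace_add, Finset.sum_add_distrib, Matrix.mul_smul,
      Matrix.trace_smul, Finset.mul_sum, Matrix.trace_sum, smul_eq_mul]
    congr 1
    -- Splitting: `E_{ab} V^{k-j} E_{ba} V^j` has trace `(V^{k-j})_{bb} (V^j)_{aa}`.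
    · have : ∀ a b : Fin n, ∀ j ∈ Finset.range k, ptrProd s V * (Matrix.single a b 1 *
          ((V : 𝕄 n) ^ (k - j) * Matrix.single b a 1 * (V : 𝕄 n) ^ j)).trace
          = ((V : 𝕄 n) ^ j) a a * ((V : 𝕄 n) ^ (k - j)) b b * ptrProd s V := by
        intro a b j _
        rw [Matrix.trace_single_mul, mul_assoc, Matrix.mul_apply]
        simp [Matrix.single_apply, Matrix.mul_apply, ite_and]
        ring
      rw [Finset.sum_congr rfl fun a _ => Finset.sum_congr rfl fun b _ =>
        Finset.sum_congr rfl (this a b)]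
      rw [Finset.sum_congr rfl fun a _ => Finset.sum_comm, Finset.sum_comm]
      refine Finset.sum_congr rfl fun j hj => ?_
      rw [← Nat.cast_sub (Finset.mem_range.1 hj).le, ptr_natCast, ptr_natCast, powTrace,
        powTrace, Matrix.trace, Matrix.trace, Finset.sum_mul_sum, Finset.sum_mul]
      simp [Finset.sum_mul]
    -- Merging: the matrix units reassemble `Tr (V^k N)`, then N is taken to be `V^x`.
    · have : ∀ N : 𝕄 n, ∑ a, ∑ b, ((V : 𝕄 n) ^ k) a b * (Matrix.single a b 1 * N).trace
          = ((V : 𝕄 n) ^ k * N).trace := by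
        intro N
        simp_rw [Matrix.trace_single_mul]
        simp [Matrix.trace, Matrix.mul_apply]
      rw [this, Finset.sum_multiset_map_count, Finset.mul_sum, Matrix.trace_sum]
      refine Finset.sum_congr rfl fun x _ => ?_
      rw [Matrix.mul_smul, Matrix.mul_smul, Matrix.trace_smul, Matrix.trace_smul, ptr, zpow_add]
      simp
      ring
  simp_rw [← integral_finsetSum Finset.univ fun b (_ : b ∈ Finset.univ) => hi _ b] at h1
  rw [← integral_finsetSum _ fun a _ => integrable_finsetSum _ fun b _ => hi a b,
    ← integral_congr_ae (Eventually.of_forall h2)] at h1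
  have hc1 : ∀ j ∈ Finset.range k, Integrable
      (fun V : 𝕌 n => ptr j V * ptr (k - j) V * ptrProd s V) (haarUnitaryMeasure n) :=
    fun j _ => integrable_of_continuous
      (((continuous_ptr _).mul (continuous_ptr _)).mul (continuous_ptrProd _))
  have hc2 : ∀ x ∈ s.toFinset, Integrable
      (fun V : 𝕌 n => (s.count x : ℂ) * x * (ptr (k + x) V * ptrProd (s.erase x) V))
      (haarUnitaryMeasure n) :=
    fun x _ => (integrable_of_continuous
      ((continuous_ptr _).mul (continuous_ptrProd _))).const_mul _
  rw [integral_add (integrable_finsetSum _ hc1) (integrable_finsetSum _ hc2),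
    integral_finsetSum _ hc1, integral_finsetSum _ hc2] at h1
  simp_rw [integral_const_mul] at h1
  exact h1

end SchwingerDyson

/-! ### Uniform moment bounds and limits of moments -/

section Moments

local notation "𝕌" n => Matrix.unitaryGroup (Fin n) ℂ

lemma norm_ptr_neg {n : ℕ} (m : ℤ) (V : 𝕌 n) : ‖ptr (-m) V‖ = ‖ptr m V‖ := by
  rw [ptr_neg, RCLike.norm_conj]

lemma integrable_norm_of_continuous {n : ℕ} {F : (𝕌 n) → ℝ} (hF : Continuous F) :
    Integrable F (haarUnitaryMeasure n) :=
  (BoundedContinuousFunction.mkOfCompact ⟨F, hF⟩).integrable (haarUnitaryMeasure n)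

lemma norm_ptrProd_of_forall {n : ℕ} {k : ℤ} {s : Multiset ℤ} (hs : ∀ x ∈ s, x = k ∨ x = -k)
    (V : 𝕌 n) : ‖ptrProd s V‖ = ‖ptr k V‖ ^ s.card := by
  induction s using Multiset.induction with
  | empty => simp
  | cons m s ih =>
    have hm : ‖ptr m V‖ = ‖ptr k V‖ := by
      rcases hs m (Multiset.mem_cons_self m s) with rfl | rfl
      · rfl
      · exact norm_ptr_neg _ _
    rw [ptrProd_cons, norm_mul, ih fun x hx => hs x (Multiset.mem_cons_of_mem hx), hm,
      Multiset.card_cons, pow_succ']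

/-- Weighted Young inequality, by comparing b with Ka. A large K makes the coefficient of `b ^ (m +
1)` small enough to be absorbed. -/
lemma mul_pow_le_add_div {a b K : ℝ} (ha : 0 ≤ a) (hb : 0 ≤ b) (hK : 0 < K) (m : ℕ) :
    a * b ^ m ≤ K ^ m * a ^ (m + 1) + b ^ (m + 1) / K := by
  rcases le_total b (K * a) with h | h
  · have : a * b ^ m ≤ a * (K * a) ^ m := by gcongr
    have h2 : 0 ≤ b ^ (m + 1) / K := by positivity
    calc a * b ^ m ≤ a * (K * a) ^ m := this
      _ = K ^ m * a ^ (m + 1) := by ring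
      _ ≤ _ := by linarith
  · have : a ≤ b / K := by rw [le_div_iff₀ hK]; linarith
    have h2 : 0 ≤ K ^ m * a ^ (m + 1) := by positivity
    calc a * b ^ m ≤ b / K * b ^ m := by gcongr
      _ = b ^ (m + 1) / K := by ring
      _ ≤ _ := by linarith

/-- The even absolute moments of order `q + 1` of `Tr (V ^ k)` are controlled by those of order
`q` and by the moments of the traces of lower powers. -/
lemma integral_norm_ptr_pow_succ_le {n k : ℕ} (hn : 0 < n) (hk : 0 < k) (q : ℕ) :
    ∫ V : 𝕌 n, ‖ptr k V‖ ^ (2 * (q + 1)) ∂haarUnitaryMeasure n ≤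
      2 * (∑ j ∈ Finset.Ico 1 k, (2 * k : ℝ) ^ (2 * q + 1) *
          ∫ V : 𝕌 n, ‖ptr j V‖ ^ (2 * (q + 1)) ∂haarUnitaryMeasure n
        + (2 * q + 1) * k * ∫ V : 𝕌 n, ‖ptr k V‖ ^ (2 * q) ∂haarUnitaryMeasure n) := by
  set μ := haarUnitaryMeasure n
  set J : ℕ → ℕ → ℝ := fun j q => ∫ V : 𝕌 n, ‖ptr j V‖ ^ (2 * q) ∂μ with hJ
  change J k (q + 1) ≤ 2 * (∑ j ∈ Finset.Ico 1 k, (2 * k : ℝ) ^ (2 * q + 1) * J j (q + 1)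
    + (2 * q + 1) * k * J k q)
  have hc : ∀ m : ℤ, Continuous fun V : 𝕌 n => ‖ptr m V‖ := fun m => (continuous_ptr m).norm
  -- With one more factor `Tr V^k`, this product becomes `|Tr V^k|^(2(q+1))`.
  set s : Multiset ℤ := Multiset.replicate q (k : ℤ) + Multiset.replicate (q + 1) (-k : ℤ)
  have hs : ∀ x ∈ s, x = (k : ℤ) ∨ x = -(k : ℤ) := by
    intro x hx
    rcases Multiset.mem_add.1 hx with h | h
    · exact Or.inl (Multiset.eq_of_mem_replicate h)
    · exact Or.inr (Multiset.eq_of_mem_replicate h)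
  have hcard : s.card = 2 * q + 1 := by simp [s]; ring
  have hn' : (0 : ℝ) < n := by exact_mod_cast hn
  have hk' : (0 : ℝ) < k := by exact_mod_cast hk
  have sd := schwingerDyson (n := n) k s
  have h0 : ∫ V : 𝕌 n, ptr ((0 : ℕ) : ℤ) V * ptr (k - (0 : ℕ)) V * ptrProd s V ∂μ
      = ((n * J k (q + 1) : ℝ) : ℂ) := by
    rw [hJ, ← integral_const_mul, ← integral_complex_ofReal]
    refine integral_congr_ae (Eventually.of_forall fun V => ?_)
    simp only [s, Nat.cast_zero, sub_zero, ptr_zero, ptrProd_add, ptrProd_replicate, ptr_neg]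
    push_cast
    rw [pow_mul, ← Complex.mul_conj']
    ring
  rw [Finset.range_eq_Ico, Finset.sum_eq_sum_Ico_succ_bot hk, h0, add_assoc] at sd
  -- Only `Tr V^{k-j}` is bounded by n, matching the n of the term j = 0; Young with K = 2k handles
  -- the rest.
  have h1 : ∀ j ∈ Finset.Ico 1 k,
      ‖∫ V : 𝕌 n, ptr (j : ℤ) V * ptr (k - j) V * ptrProd s V ∂μ‖
        ≤ n * ((2 * k : ℝ) ^ (2 * q + 1) * J j (q + 1) + J k (q + 1) / (2 * k)) := by
    intro j _
    refine (norm_integral_le_integral_norm _).trans ?_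
    rw [hJ, ← integral_const_mul, ← integral_div, ← integral_add, ← integral_const_mul]
    rotate_left
    · exact integrable_norm_of_continuous (((hc _).pow _).const_mul _)
    · exact integrable_norm_of_continuous (((hc _).pow _).div_const _)
    refine integral_mono (integrable_norm_of_continuous (((continuous_ptr _).mul
      (continuous_ptr _)).mul (continuous_ptrProd _)).norm) (integrable_norm_of_continuous
      (((((hc _).pow _).const_mul _).add (((hc _).pow _).div_const _)).const_mul _))
      fun V => ?_
    simp only [norm_mul]
    rw [norm_ptrProd_of_forall hs, hcard]
    calc ‖ptr (j : ℤ) V‖ * ‖ptr (k - j : ℤ) V‖ * ‖ptr (k : ℤ) V‖ ^ (2 * q + 1)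
        ≤ ‖ptr (j : ℤ) V‖ * n * ‖ptr (k : ℤ) V‖ ^ (2 * q + 1) := by
          gcongr; exact norm_ptr_le _ _
      _ = n * (‖ptr (j : ℤ) V‖ * ‖ptr (k : ℤ) V‖ ^ (2 * q + 1)) := by ring
      _ ≤ _ := by
          gcongr
          exact mul_pow_le_add_div (norm_nonneg _) (norm_nonneg _) (by positivity) (2 * q + 1)
  have h2 : ∀ x ∈ s.toFinset, ‖(s.count x : ℂ) * x *
      ∫ V : 𝕌 n, ptr (k + x) V * ptrProd (s.erase x) V ∂μ‖
        ≤ s.count x * (k * (n * J k q)) := by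
    intro x hx
    rw [Multiset.mem_toFinset] at hx
    have hxk : ‖(x : ℂ)‖ = k := by rcases hs x hx with rfl | rfl <;> simp
    rw [norm_mul, norm_mul, hxk, Complex.norm_natCast, mul_assoc]
    gcongr
    refine (norm_integral_le_integral_norm _).trans ?_
    rw [hJ, ← integral_const_mul]
    refine integral_mono (integrable_norm_of_continuous ((continuous_ptr _).mul
      (continuous_ptrProd _)).norm) (integrable_norm_of_continuous
      (((hc _).pow _).const_mul _)) fun V => ?_
    simp only [norm_mul]
    rw [norm_ptrProd_of_forall fun y hy => hs y (Multiset.mem_of_mem_erase hy),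
      Multiset.card_erase_of_mem hx, hcard]
    exact mul_le_mul_of_nonneg_right (norm_ptr_le _ _) (by positivity)
  have h3 : (n : ℝ) * J k (q + 1) ≤
      ∑ j ∈ Finset.Ico 1 k, (n * ((2 * k : ℝ) ^ (2 * q + 1) * J j (q + 1)
        + J k (q + 1) / (2 * k))) + ∑ x ∈ s.toFinset, s.count x * (k * (n * J k q)) := by
    refine (le_abs_self _).trans ?_
    rw [← Real.norm_eq_abs, ← Complex.norm_real, eq_neg_of_add_eq_zero_left sd, norm_neg]
    refine (norm_add_le _ _).trans (add_le_add ?_ ?_)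
    · exact (norm_sum_le _ _).trans (Finset.sum_le_sum h1)
    · exact (norm_sum_le _ _).trans (Finset.sum_le_sum h2)
  have hsum : ∑ x ∈ s.toFinset, (s.count x : ℝ) = 2 * q + 1 := by
    rw [← Nat.cast_sum, Multiset.toFinset_sum_count_eq, hcard]; push_cast; ring
  have hI : 0 ≤ J k (q + 1) := integral_nonneg fun V => by positivity
  rw [← Finset.sum_mul, hsum, ← Finset.mul_sum, Finset.sum_add_distrib, Finset.sum_const,
    Nat.card_Ico, nsmul_eq_mul, Nat.cast_sub hk] at h3
  -- The k - 1 Young remainders, each 1/(2k) of the top moment, add up to at most half of it and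
  -- move to the left side.
  have h4 : ((k : ℝ) - (1 : ℕ)) * (J k (q + 1) / (2 * k)) ≤ J k (q + 1) / 2 := by
    rw [Nat.cast_one, mul_div_assoc', div_le_div_iff₀ (by positivity) two_pos]
    nlinarith
  have h5 : J k (q + 1) ≤ ∑ j ∈ Finset.Ico 1 k, (2 * k : ℝ) ^ (2 * q + 1) * J j (q + 1)
      + (k - (1 : ℕ)) * (J k (q + 1) / (2 * k)) + (2 * q + 1) * (k * J k q) := by
    refine le_of_mul_le_mul_left (h3.trans (le_of_eq ?_)) hn'
    push_cast
    ring
  linarith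

/-- The absolute moments of `Tr (V ^ k)` are bounded uniformly in the dimension. -/
lemma exists_integral_norm_ptr_pow_le (k : ℕ) (hk : 0 < k) (q : ℕ) :
    ∃ C, ∀ n, ∫ V : 𝕌 n, ‖ptr k V‖ ^ (2 * q) ∂haarUnitaryMeasure n ≤ C := by
  -- Outer induction on the power k, inner induction on the order q: the estimate needs all smaller
  -- powers at order q + 1 and the same power at order q.
  induction k using Nat.strong_induction_on generalizing q with
  | _ k ihk =>
  induction q with
  | zero => exact ⟨1, fun n => by simp⟩
  | succ q ihq =>
    obtain ⟨C, hC⟩ := ihq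
    have : ∀ j, ∃ D, j ∈ Finset.Ico 1 k →
        ∀ n, ∫ V : 𝕌 n, ‖ptr j V‖ ^ (2 * (q + 1)) ∂haarUnitaryMeasure n ≤ D := by
      intro j
      by_cases hj : j ∈ Finset.Ico 1 k
      · obtain ⟨D, hD⟩ := ihk j (Finset.mem_Ico.1 hj).2 (Finset.mem_Ico.1 hj).1 (q + 1)
        exact ⟨D, fun _ => hD⟩
      · exact ⟨0, fun h => absurd h hj⟩
    choose D hD using this
    refine ⟨max 0 (2 * (∑ j ∈ Finset.Ico 1 k, (2 * k : ℝ) ^ (2 * q + 1) * D j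
      + (2 * q + 1) * k * C)), fun n => ?_⟩
    -- The estimate divides by n; for n = 0 the trace vanishes.
    rcases Nat.eq_zero_or_pos n with rfl | hn
    · refine le_max_of_le_left (integral_nonpos fun V => ?_)
      have : ‖ptr k V‖ = 0 := le_antisymm (by simpa using norm_ptr_le (n := 0) k V) (norm_nonneg _)
      simp [this]
    · refine le_max_of_le_right ((integral_norm_ptr_pow_succ_le hn hk q).trans ?_)
      gcongr with j hj
      · exact hD j hj n
      · exact hC n

/-- The absolute moments of products of power traces are bounded uniformly in the dimension. -/
lemma exists_integral_norm_ptrProd_pow_le (s : Multiset ℤ) (hs : (0 : ℤ) ∉ s) (r : ℕ) :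
    ∃ C, ∀ n, ∫ V : 𝕌 n, ‖ptrProd s V‖ ^ r ∂haarUnitaryMeasure n ≤ C := by
  induction s using Multiset.induction generalizing r with
  | empty => exact ⟨1, fun n => by simp⟩
  | cons m s ih =>
    -- Order 2r is needed because `|xy|^r ≤ |x|^(2r) + |y|^(2r)`.
    obtain ⟨C, hC⟩ := ih (fun h => hs (Multiset.mem_cons_of_mem h)) (2 * r)
    have hm : m ≠ 0 := fun h => hs (h ▸ Multiset.mem_cons_self m s)
    obtain ⟨D, hD⟩ := exists_integral_norm_ptr_pow_le m.natAbs (Int.natAbs_pos.2 hm) r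
    refine ⟨D + C, fun n => ?_⟩
    have hnorm : ∀ V : 𝕌 n, ‖ptr m V‖ = ‖ptr (m.natAbs : ℤ) V‖ := fun V => by
      rcases m.natAbs_eq with h | h
      · rw [← h]
      · conv_lhs => rw [h, norm_ptr_neg]
    have h1 : Continuous fun V : 𝕌 n => ‖ptr (m.natAbs : ℤ) V‖ ^ (2 * r) :=
      (continuous_ptr _).norm.pow _
    have h2 : Continuous fun V : 𝕌 n => ‖ptrProd s V‖ ^ (2 * r) :=
      (continuous_ptrProd _).norm.pow _
    refine le_trans ?_ (add_le_add (hD n) (hC n))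
    rw [← integral_add (integrable_norm_of_continuous h1) (integrable_norm_of_continuous h2)]
    refine integral_mono (integrable_norm_of_continuous
      ((continuous_ptrProd _).norm.pow _)) (integrable_norm_of_continuous (h1.add h2)) fun V => ?_
    simp only [ptrProd_cons, norm_mul, hnorm]
    rw [mul_pow, mul_comm 2 r, pow_mul, pow_mul]
    nlinarith [sq_nonneg (‖ptr (m.natAbs : ℤ) V‖ ^ r - ‖ptrProd s V‖ ^ r),
      sq_nonneg (‖ptr (m.natAbs : ℤ) V‖ ^ r), sq_nonneg (‖ptrProd s V‖ ^ r)]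

/-- The numerator is bounded uniformly in n. Excluding 0 from s is essential, as `Tr V^0 = n`. -/
lemma tendsto_integral_ptrProd_div (s : Multiset ℤ) (hs : (0 : ℤ) ∉ s) :
    Tendsto (fun n : ℕ => (∫ V : 𝕌 n, ptrProd s V ∂haarUnitaryMeasure n) / n) atTop (𝓝 0) := by
  obtain ⟨C, hC⟩ := exists_integral_norm_ptrProd_pow_le s hs 1
  refine squeeze_zero_norm (a := fun n : ℕ => C / n) (fun n => ?_)
    (tendsto_const_div_atTop_nhds_zero_nat C)
  rw [norm_div, Complex.norm_natCast]
  gcongr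
  exact (norm_integral_le_integral_norm _).trans (by simpa using hC n)

/-- Asymptotically, `Tr (V ^ k)` is contracted with the factors `Tr (V ^ (-k))`. -/
lemma tendsto_integral_ptrProd_cons {k : ℕ} (hk : 0 < k) {s : Multiset ℤ} (hs : (0 : ℤ) ∉ s)
    {L : ℂ} (hL : (-k : ℤ) ∈ s → Tendsto (fun n : ℕ =>
      ∫ V : 𝕌 n, ptrProd (s.erase (-k : ℤ)) V ∂haarUnitaryMeasure n) atTop (𝓝 L)) :
    Tendsto (fun n : ℕ => ∫ V : 𝕌 n, ptrProd ((k : ℤ) ::ₘ s) V ∂haarUnitaryMeasure n) atTop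
      (𝓝 (s.count (-k : ℤ) * k * L)) := by
  -- For 1 ≤ j < k neither j nor k - j is zero, so the splitting terms are O(1/n).
  have h1 : Tendsto (fun n : ℕ => ∑ j ∈ Finset.Ico 1 k,
      (∫ V : 𝕌 n, ptr j V * ptr (k - j) V * ptrProd s V ∂haarUnitaryMeasure n) / n) atTop
      (𝓝 (∑ j ∈ Finset.Ico 1 k, 0)) := by
    refine tendsto_finsetSum _ fun j hj => ?_
    have hj := Finset.mem_Ico.1 hj
    have := tendsto_integral_ptrProd_div ((j : ℤ) ::ₘ (k - j : ℤ) ::ₘ s) (by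
      simp only [Multiset.mem_cons, not_or]
      exact ⟨by omega, by omega, hs⟩)
    simpa [mul_assoc] using this
  have h2 : Tendsto (fun n : ℕ => ∑ x ∈ s.toFinset, (s.count x : ℂ) * x *
      ((∫ V : 𝕌 n, ptr (k + x) V * ptrProd (s.erase x) V ∂haarUnitaryMeasure n) / n)) atTop
      (𝓝 (∑ x ∈ s.toFinset, (s.count x : ℂ) * x * (if x = -k then L else 0))) := by
    refine tendsto_finsetSum _ fun x hx => Tendsto.const_mul _ ?_
    rw [Multiset.mem_toFinset] at hx
    -- For x = -k the factor `Tr V^0 = n` cancels the division by n; any other x leaves a bounded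
    -- moment, since k + x ≠ 0.
    split_ifs with h
    · subst h
      refine (hL hx).congr' ?_
      filter_upwards [eventually_gt_atTop 0] with n hn
      have hn' : (n : ℂ) ≠ 0 := by exact_mod_cast hn.ne'
      simp_rw [add_neg_cancel, ptr_zero, integral_const_mul]
      rw [mul_div_cancel_left₀ _ hn']
    · have := tendsto_integral_ptrProd_div ((k + x : ℤ) ::ₘ s.erase x) (by
        simp only [Multiset.mem_cons, not_or]
        exact ⟨by omega, fun h0 => hs (Multiset.mem_of_mem_erase h0)⟩)
      simpa using this
  have h3 := (h1.add h2).neg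
  refine (h3.congr' ?_).trans (le_of_eq ?_)
  · filter_upwards [eventually_gt_atTop 0] with n hn
    have hn' : (n : ℂ) ≠ 0 := by exact_mod_cast hn.ne'
    have sd := schwingerDyson (n := n) k s
    rw [Finset.range_eq_Ico, Finset.sum_eq_sum_Ico_succ_bot hk, add_assoc] at sd
    simp only [Nat.cast_zero, ptr_zero, sub_zero, mul_assoc (n : ℂ), integral_const_mul] at sd
    simp only [ptrProd_cons]
    rw [← mul_right_inj' hn', eq_neg_of_add_eq_zero_left sd, mul_neg, mul_add, Finset.mul_sum,
      Finset.mul_sum]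
    congr 2
    · exact Finset.sum_congr rfl fun j _ => (mul_div_cancel₀ _ hn')
    · refine Finset.sum_congr rfl fun j _ => ?_
      field_simp
  · congr 1
    by_cases h : (-k : ℤ) ∈ s
    · simp [h]
    · simp [h]

end Moments

/-! ### Limits of mixed moments by iterated contraction -/

section MixedMoments

local notation "𝕌" n => Matrix.unitaryGroup (Fin n) ℂ

variable {l : ℕ}

/-- The multiset with `a i` copies of `i + 1` and `b i` copies of `-(i + 1)`. -/
def signedExponents (a b : Fin l → ℕ) : Multiset ℤ :=
  ∑ i : Fin l, (Multiset.replicate (a i) ((i.val + 1 : ℕ) : ℤ)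
    + Multiset.replicate (b i) (-((i.val + 1 : ℕ) : ℤ)))

lemma zero_notMem_signedExponents (a b : Fin l → ℕ) : (0 : ℤ) ∉ signedExponents a b := by
  simp only [signedExponents, Multiset.mem_sum, Multiset.mem_add, not_exists, not_and, not_or]
  refine fun i _ => ⟨fun h => ?_, fun h => ?_⟩ <;>
  · have := Multiset.eq_of_mem_replicate h
    omega

lemma count_neg_signedExponents (a b : Fin l → ℕ) (i : Fin l) :
    (signedExponents a b).count (-((i.val + 1 : ℕ) : ℤ)) = b i := by
  rw [signedExponents, Multiset.count_sum', Finset.sum_eq_single i]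
  · have : ((i.val + 1 : ℕ) : ℤ) ≠ -((i.val + 1 : ℕ) : ℤ) := by omega
    rw [Multiset.count_add, Multiset.count_replicate, Multiset.count_replicate, if_neg this,
      if_pos rfl, zero_add]
  · intro j _ hj
    have hj : j.val ≠ i.val := fun h => hj (Fin.ext h)
    rw [Multiset.count_add, Multiset.count_replicate, Multiset.count_replicate,
      if_neg (by omega), if_neg (by omega), add_zero]
  · simp

lemma signedExponents_add (a a' b b' : Fin l → ℕ) :
    signedExponents (a + a') (b + b') = signedExponents a b + signedExponents a' b' := by
  simp only [signedExponents, Pi.add_apply, Multiset.replicate_add, ← Finset.sum_add_distrib]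
  exact Finset.sum_congr rfl fun i _ => add_add_add_comm _ _ _ _

lemma signedExponents_single_left (i : Fin l) :
    signedExponents (Pi.single i 1) 0 = {((i.val + 1 : ℕ) : ℤ)} := by
  rw [signedExponents, Finset.sum_eq_single i]
  · simp
  · intro j _ hj; simp [hj]
  · simp

lemma signedExponents_single_right (i : Fin l) :
    signedExponents 0 (Pi.single i 1) = {-((i.val + 1 : ℕ) : ℤ)} := by
  rw [signedExponents, Finset.sum_eq_single i]
  · simp
  · intro j _ hj; simp [hj]
  · simp

lemma ptrProd_signedExponents {n : ℕ} (a b : Fin l → ℕ) (V : 𝕌 n) :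
    ptrProd (signedExponents a b) V = mixedMonomial a b fun i => powTrace (i.val + 1) V := by
  have : ∀ (t : Finset (Fin l)) (f : Fin l → Multiset ℤ),
      ptrProd (∑ i ∈ t, f i) V = ∏ i ∈ t, ptrProd (f i) V := by
    intro t f
    induction t using Finset.cons_induction with
    | empty => simp
    | cons i t hi ih => rw [Finset.sum_cons, Finset.prod_cons, ptrProd_add, ih]
  rw [signedExponents, this, mixedMonomial]
  refine Finset.prod_congr rfl fun i _ => ?_
  rw [ptrProd_add, ptrProd_replicate, ptrProd_replicate, ptr_neg, ptr_natCast]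

lemma exists_eq_add_single {a : Fin l → ℕ} {i : Fin l} (hi : a i ≠ 0) :
    ∃ a' : Fin l → ℕ, a = a' + Pi.single i 1 := by
  refine ⟨a - Pi.single i 1, ?_⟩
  funext j
  by_cases h : j = i
  · subst h; simp; omega
  · simp [h]

/-- A factor `Tr V^(i+1)` has no conjugate partner to be contracted with. -/
lemma tendsto_integral_signedExponents_zero {a b : Fin l → ℕ} {i : Fin l} (ha : a i ≠ 0)
    (hb : b i = 0) : Tendsto (fun n : ℕ => ∫ V : 𝕌 n, ptrProd (signedExponents a b) V
      ∂haarUnitaryMeasure n) atTop (𝓝 0) := by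
  obtain ⟨a', rfl⟩ := exists_eq_add_single ha
  have h := tendsto_integral_ptrProd_cons (k := i.val + 1) (Nat.succ_pos _)
    (zero_notMem_signedExponents a' b) (L := 0) (fun h => by
      rw [← Multiset.count_pos, count_neg_signedExponents] at h; omega)
  rw [mul_zero] at h
  have e : signedExponents (a' + Pi.single i 1) b
      = ((i.val + 1 : ℕ) : ℤ) ::ₘ signedExponents a' b := by
    conv_lhs => rw [← add_zero b, signedExponents_add, signedExponents_single_left]
    rw [add_comm, Multiset.singleton_add]
  rwa [e]

lemma conj_ptrProd_signedExponents {n : ℕ} (a b : Fin l → ℕ) (V : 𝕌 n) :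
    starRingEnd ℂ (ptrProd (signedExponents a b) V) = ptrProd (signedExponents b a) V := by
  rw [ptrProd_signedExponents, ptrProd_signedExponents, mixedMonomial, mixedMonomial, map_prod]
  refine Finset.prod_congr rfl fun i _ => ?_
  simp [mul_comm]

/-- The joint moments of `Tr V, …, Tr V ^ l` for a Haar unitary matrix `V` converge. -/
theorem tendsto_integral_signedExponents (a b : Fin l → ℕ) :
    Tendsto (fun n : ℕ => ∫ V : 𝕌 n, ptrProd (signedExponents a b) V
      ∂haarUnitaryMeasure n) atTop
      (𝓝 (∏ i, if a i = b i then ((a i).factorial : ℂ) * ((i.val : ℂ) + 1) ^ a i else 0)) := by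
  induction hN : ∑ i, a i using Nat.strong_induction_on generalizing a b with
  | _ N ih =>
  by_cases ha : a = 0
  · subst ha
    by_cases hb : b = 0
    · subst hb
      simp [signedExponents]
    · obtain ⟨i, hi⟩ := Function.ne_iff.1 hb
      -- Only conjugated traces remain; conjugation exchanges a and b and reduces to the unpartnered
      -- case.
      have h := tendsto_integral_signedExponents_zero (b := 0) hi rfl
      have h' := (Complex.continuous_conj.tendsto _).comp h
      simp only [Function.comp_def, ← integral_conj, conj_ptrProd_signedExponents, map_zero] at h'
      rwa [Finset.prod_eq_zero (Finset.mem_univ i) (if_neg (Ne.symm hi))]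
  · obtain ⟨i, hi⟩ := Function.ne_iff.1 ha
    by_cases hb : b i = 0
    · rw [Finset.prod_eq_zero (Finset.mem_univ i) (if_neg (by rw [hb]; exact hi))]
      exact tendsto_integral_signedExponents_zero hi hb
    · obtain ⟨a', rfl⟩ := exists_eq_add_single hi
      obtain ⟨b', rfl⟩ := exists_eq_add_single hb
      have hlt : ∑ j, a' j < N := by
        rw [← hN]
        simp [Finset.sum_add_distrib]
      have h := ih _ hlt a' b' rfl
      have e1 : signedExponents (a' + Pi.single i 1) (b' + Pi.single i 1)
          = ((i.val + 1 : ℕ) : ℤ) ::ₘ signedExponents a' (b' + Pi.single i 1) := by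
        conv_lhs => rw [← add_zero (b' + Pi.single i 1), signedExponents_add,
          signedExponents_single_left]
        rw [add_comm, Multiset.singleton_add]
      have e2 : signedExponents a' (b' + Pi.single i 1)
          = (-((i.val + 1 : ℕ) : ℤ)) ::ₘ signedExponents a' b' := by
        conv_lhs => rw [← add_zero a', signedExponents_add, signedExponents_single_right]
        rw [add_comm, Multiset.singleton_add]
      -- One contraction has `b' i + 1` possible partners, each of weight `i + 1`; when `a' i = b'
      -- i` these advance the factorial and the power by one.
      have h2 := tendsto_integral_ptrProd_cons (k := i.val + 1) (Nat.succ_pos _)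
        (zero_notMem_signedExponents a' (b' + Pi.single i 1)) (fun _ => by
          simp only [e2, Multiset.erase_cons_head]
          exact h)
      rw [count_neg_signedExponents] at h2
      rw [e1]
      convert h2 using 2
      rw [← Finset.mul_prod_erase _ _ (Finset.mem_univ i),
        ← Finset.mul_prod_erase Finset.univ (fun i => if a' i = b' i then _ else _)
          (Finset.mem_univ i), ← mul_assoc]
      congr 1
      · by_cases hab : a' i = b' i
        · simp [hab, Nat.factorial_succ]
          ring
        · simp [hab]
      · refine Finset.prod_congr rfl fun j hj => ?_
        simp [Finset.ne_of_mem_erase hj]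

end MixedMoments

/-! ### The method of moments for complex random vectors -/

section MethodOfMoments

/-- The derivative of the remainder of order m + 1 is i times the remainder of order m, so the bound
integrates up by induction. -/
lemma norm_cexp_sub_sum_le_of_nonneg (m : ℕ) {x : ℝ} (hx : 0 ≤ x) :
    ‖Complex.exp (x * Complex.I) - ∑ j ∈ Finset.range m, (x * Complex.I) ^ j / (j.factorial : ℂ)‖
      ≤ x ^ m / m.factorial := by
  induction m generalizing x with
  | zero => simp [Complex.norm_exp_ofReal_mul_I]
  | succ m ih =>
    have hd : ∀ s : ℝ, HasDerivAt (fun s : ℝ => Complex.exp (s * Complex.I)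
        - ∑ j ∈ Finset.range (m + 1), (s * Complex.I) ^ j / (j.factorial : ℂ))
        (Complex.I * (Complex.exp (s * Complex.I)
          - ∑ j ∈ Finset.range m, (s * Complex.I) ^ j / (j.factorial : ℂ))) s := by
      intro s
      have h1 : HasDerivAt (fun s : ℝ => (s : ℂ) * Complex.I) Complex.I s := by
        simpa using (Complex.ofRealCLM.hasDerivAt (x := s)).mul_const Complex.I
      have h2 := HasDerivAt.fun_sum (u := Finset.range (m + 1)) fun j _ =>
        (h1.fun_pow j).div_const (j.factorial : ℂ)
      refine (h1.cexp.sub h2).congr_deriv ?_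
      rw [Finset.sum_range_succ', mul_sub, Finset.mul_sum]
      simp only [Nat.cast_zero, zero_mul, zero_div, add_zero, Nat.add_sub_cancel]
      congr 1
      · ring
      · refine Finset.sum_congr rfl fun j _ => ?_
        have h3 : ((j + 1 : ℕ) : ℂ) ≠ 0 := by exact_mod_cast Nat.succ_ne_zero j
        have h4 : (j.factorial : ℂ) ≠ 0 := by exact_mod_cast j.factorial_ne_zero
        rw [Nat.factorial_succ, Nat.cast_mul]
        field_simp
    have hB : ∀ s : ℝ, HasDerivAt (fun s : ℝ => s ^ (m + 1) / ((m + 1).factorial : ℝ))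
        (s ^ m / m.factorial) s := by
      intro s
      refine ((hasDerivAt_pow (m + 1) s).div_const _).congr_deriv ?_
      have h3 : ((m + 1 : ℕ) : ℝ) ≠ 0 := by exact_mod_cast Nat.succ_ne_zero m
      have h4 : (m.factorial : ℝ) ≠ 0 := by exact_mod_cast m.factorial_ne_zero
      rw [Nat.factorial_succ, Nat.cast_mul, Nat.add_sub_cancel]
      field_simp
    refine image_norm_le_of_norm_deriv_right_le_deriv_boundary (a := 0) (b := x)
      (fun s _ => (hd s).continuousAt.continuousWithinAt)
      (fun s _ => (hd s).hasDerivWithinAt) ?_ hB (fun s hs => ?_) ⟨hx, le_rfl⟩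
    · simp [Finset.sum_range_succ']
    · rw [norm_mul, Complex.norm_I, one_mul]
      exact ih hs.1

lemma norm_cexp_sub_sum_le (m : ℕ) (x : ℝ) :
    ‖Complex.exp (x * Complex.I) - ∑ j ∈ Finset.range m, (x * Complex.I) ^ j / (j.factorial : ℂ)‖
      ≤ |x| ^ m / m.factorial := by
  rcases le_total 0 x with h | h
  · rw [abs_of_nonneg h]
    exact norm_cexp_sub_sum_le_of_nonneg m h
  · rw [abs_of_nonpos h]
    refine le_of_eq_of_le ?_ (norm_cexp_sub_sum_le_of_nonneg m (neg_nonneg.2 h))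
    rw [← RCLike.norm_conj]
    simp [← Complex.exp_conj, map_sum]

/-- Each Taylor term is dominated by `exp |y|` and tends to 0 pointwise. -/
lemma tendsto_integral_pow_div_factorial {Ω' : Type*} [MeasurableSpace Ω'] {P' : Measure Ω'}
    {y : Ω' → ℝ} (hy : AEStronglyMeasurable y P')
    (hexp : Integrable (fun ω => Real.exp |y ω|) P') :
    Tendsto (fun m : ℕ => ∫ ω, |y ω| ^ m / m.factorial ∂P') atTop (𝓝 0) := by
  rw [← integral_zero Ω' ℝ (μ := P')]
  refine tendsto_integral_of_dominated_convergence _ (fun m => ?_) hexp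
    (fun m => Eventually.of_forall fun ω => ?_) (Eventually.of_forall fun ω => ?_)
  · have hc : Continuous fun r : ℝ => |r| ^ m / (m.factorial : ℝ) := by fun_prop
    exact hc.comp_aestronglyMeasurable hy
  · rw [Real.norm_of_nonneg (by positivity)]
    exact Real.pow_div_factorial_le_exp _ (abs_nonneg _) m
  · exact FloorSemiring.tendsto_pow_div_factorial_atTop _

/-- Comparison of `E (exp (i z))` with the expectation of its Taylor polynomial. -/
lemma norm_integral_cexp_sub_le {Ω : Type*} [MeasurableSpace Ω] {Q : Measure Ω}
    [IsProbabilityMeasure Q] {z : Ω → ℝ} (hz : AEStronglyMeasurable z Q)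
    (hzi : ∀ m, Integrable (fun ω => (z ω : ℂ) ^ m) Q) (N : ℕ) :
    ‖∫ ω, Complex.exp (z ω * Complex.I) ∂Q - ∑ j ∈ Finset.range (2 * N),
        (Complex.I ^ j / (j.factorial : ℂ)) * ∫ ω, (z ω : ℂ) ^ j ∂Q‖
      ≤ ‖∫ ω, (z ω : ℂ) ^ (2 * N) ∂Q‖ / (2 * N).factorial := by
  have h1 : Integrable (fun ω => Complex.exp (z ω * Complex.I)) Q := by
    refine Integrable.of_bound ?_ 1 (Eventually.of_forall fun ω => ?_)
    · have hc : Continuous fun r : ℝ => Complex.exp (r * Complex.I) := by fun_prop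
      exact hc.comp_aestronglyMeasurable hz
    · rw [Complex.norm_exp_ofReal_mul_I]
  have h2 : ∀ j ∈ Finset.range (2 * N),
      Integrable (fun ω => (Complex.I ^ j / (j.factorial : ℂ)) * (z ω : ℂ) ^ j) Q :=
    fun j _ => (hzi j).const_mul _
  have h3 : Integrable (fun ω => z ω ^ (2 * N)) Q := by
    have := (hzi (2 * N)).re
    refine this.congr (Eventually.of_forall fun ω => ?_)
    simp only [← Complex.ofReal_pow, RCLike.re_to_complex, Complex.ofReal_re]
  simp_rw [← integral_const_mul]
  rw [← integral_finsetSum _ h2, ← integral_sub h1 (integrable_finsetSum _ h2)]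
  refine (norm_integral_le_integral_norm _).trans ?_
  have e : ∫ ω, (z ω : ℂ) ^ (2 * N) ∂Q = ((∫ ω, z ω ^ (2 * N) ∂Q : ℝ) : ℂ) := by
    rw [← integral_complex_ofReal]
    simp
  rw [e, Complex.norm_real]
  refine le_trans ?_ (div_le_div_of_nonneg_right (le_abs_self _) (Nat.cast_nonneg _))
  rw [← integral_div]
  refine integral_mono (h1.sub (integrable_finsetSum _ h2)).norm (h3.div_const _) fun ω => ?_
  have h4 := norm_cexp_sub_sum_le (2 * N) (z ω)
  -- At even order the absolute value disappears, so the remainder is controlled by an actual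
  -- moment.
  rw [(even_two_mul N).pow_abs] at h4
  refine le_of_eq_of_le ?_ h4
  simp only
  congr 2
  exact Finset.sum_congr rfl fun j _ => by rw [mul_pow]; ring

/-- Convergence of all moments of real random variables to those of a variable with an
exponential moment implies convergence of `E (exp (i y))`. -/
lemma tendsto_integral_cexp_of_moments {Ω : ℕ → Type*} [∀ n, MeasurableSpace (Ω n)]
    {P : ∀ n, Measure (Ω n)} [∀ n, IsProbabilityMeasure (P n)]
    {Ω' : Type*} [MeasurableSpace Ω'] {P' : Measure Ω'} [IsProbabilityMeasure P']
    {x : ∀ n, Ω n → ℝ} {y : Ω' → ℝ}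
    (hx : ∀ n, AEStronglyMeasurable (x n) (P n)) (hy : AEStronglyMeasurable y P')
    (hexp : Integrable (fun ω => Real.exp |y ω|) P')
    (hxi : ∀ m n, Integrable (fun ω => (x n ω : ℂ) ^ m) (P n))
    (hyi : ∀ m, Integrable (fun ω => (y ω : ℂ) ^ m) P')
    (hlim : ∀ m, Tendsto (fun n => ∫ ω, (x n ω : ℂ) ^ m ∂(P n)) atTop
      (𝓝 (∫ ω, (y ω : ℂ) ^ m ∂P'))) :
    Tendsto (fun n => ∫ ω, Complex.exp (x n ω * Complex.I) ∂(P n)) atTop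
      (𝓝 (∫ ω, Complex.exp (y ω * Complex.I) ∂P')) := by
  rw [Metric.tendsto_atTop]
  intro ε hε
  -- N is fixed by the limit variable alone; the remainder of `x n` is then controlled for large n
  -- by convergence of its moment of order 2N. Error budget: ε/8 + ε/2 + ε/8.
  have hN := ((tendsto_integral_pow_div_factorial hy hexp).comp
    (tendsto_id.const_mul_atTop' (r := 2) two_pos)).eventually_lt_const
      (show (0 : ℝ) < ε / 8 by positivity)
  obtain ⟨N, hN⟩ := hN.exists
  have hm : ‖∫ ω, (y ω : ℂ) ^ (2 * N) ∂P'‖ / (2 * N).factorial < ε / 8 := by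
    refine lt_of_le_of_lt ?_ hN
    simp only [Function.comp_apply, id]
    rw [integral_div]
    gcongr
    refine (norm_integral_le_integral_norm _).trans (le_of_eq ?_)
    simp
  have h1 : ∀ᶠ n in atTop, ‖∫ ω, (x n ω : ℂ) ^ (2 * N) ∂(P n)‖ / (2 * N).factorial < ε / 8 :=
    ((hlim (2 * N)).norm.div_const _).eventually_lt_const hm
  have h2 : Tendsto (fun n => ∑ j ∈ Finset.range (2 * N),
        (Complex.I ^ j / (j.factorial : ℂ)) * ∫ ω, (x n ω : ℂ) ^ j ∂(P n)) atTop
      (𝓝 (∑ j ∈ Finset.range (2 * N),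
        (Complex.I ^ j / (j.factorial : ℂ)) * ∫ ω, (y ω : ℂ) ^ j ∂P')) :=
    tendsto_finsetSum _ fun j _ => (hlim j).const_mul _
  have h3 := (Metric.tendsto_nhds.1 h2) (ε / 2) (by positivity)
  obtain ⟨M, hM⟩ := eventually_atTop.1 (h1.and h3)
  refine ⟨M, fun n hn => ?_⟩
  obtain ⟨h4, h5⟩ := hM n hn
  have h6 := norm_integral_cexp_sub_le (hx n) (fun m => hxi m n) N
  have h7 := norm_integral_cexp_sub_le hy hyi N
  rw [← dist_eq_norm] at h6 h7
  rw [dist_comm] at h7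
  refine (dist_triangle4 _ _ _ _).trans_lt (lt_of_le_of_lt (add_le_add_three h6 h5.le h7) ?_)
  linarith

/-! ### From real variables to complex vectors -/

section Vector

variable {l : ℕ} {Ω : ℕ → Type*} [∀ n, MeasurableSpace (Ω n)]
  {P : ∀ n, Measure (Ω n)} {Ω' : Type*} [MeasurableSpace Ω'] {P' : Measure Ω'}

lemma mixedMonomial_add (a a' b b' : Fin l → ℕ) (z : Fin l → ℂ) :
    mixedMonomial (a + a') (b + b') z = mixedMonomial a b z * mixedMonomial a' b' z := by
  simp only [mixedMonomial, ← Finset.prod_mul_distrib, Pi.add_apply, pow_add]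
  exact Finset.prod_congr rfl fun i _ => by ring

lemma mixedMonomial_single_left (i : Fin l) (z : Fin l → ℂ) :
    mixedMonomial (Pi.single i 1) 0 z = z i := by
  rw [mixedMonomial, Finset.prod_eq_single i]
  · simp
  · intro j _ hj; simp [hj]
  · simp

lemma mixedMonomial_single_right (i : Fin l) (z : Fin l → ℂ) :
    mixedMonomial 0 (Pi.single i 1) z = starRingEnd ℂ (z i) := by
  rw [mixedMonomial, Finset.prod_eq_single i]
  · simp
  · intro j _ hj; simp [hj]
  · simp

/-- The space of polynomials in the coordinates and their conjugates. -/
def mixedPolynomials (l : ℕ) : Submodule ℂ ((Fin l → ℂ) → ℂ) :=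
  Submodule.span ℂ (Set.range fun p : (Fin l → ℕ) × (Fin l → ℕ) => mixedMonomial p.1 p.2)

lemma mixedMonomial_mem (a b : Fin l → ℕ) : mixedMonomial a b ∈ mixedPolynomials l :=
  Submodule.subset_span ⟨(a, b), rfl⟩

lemma mul_mem_mixedPolynomials {f g : (Fin l → ℂ) → ℂ} (hf : f ∈ mixedPolynomials l)
    (hg : g ∈ mixedPolynomials l) : f * g ∈ mixedPolynomials l := by
  have h := Submodule.mul_mem_mul hf hg
  rw [mixedPolynomials, Submodule.span_mul_span] at h
  refine Submodule.span_mono ?_ h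
  rintro _ ⟨_, ⟨p, rfl⟩, _, ⟨q, rfl⟩, rfl⟩
  exact ⟨p + q, funext fun z => mixedMonomial_add p.1 q.1 p.2 q.2 z⟩

lemma pow_mem_mixedPolynomials {f : (Fin l → ℂ) → ℂ} (hf : f ∈ mixedPolynomials l) (m : ℕ) :
    f ^ m ∈ mixedPolynomials l := by
  induction m with
  | zero =>
    convert mixedMonomial_mem (l := l) 0 0 using 1
    funext z; simp [mixedMonomial]
  | succ m ih => rw [pow_succ]; exact mul_mem_mixedPolynomials ih hf

/-- The real inner product is a sum of real parts, each half the sum of a number and its conjugate.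
Hence moments of real linear functionals are combinations of mixed moments. -/
lemma inner_mem_mixedPolynomials (t : EuclideanSpace ℂ (Fin l)) :
    (fun z : Fin l → ℂ => ((inner ℝ (WithLp.toLp 2 z) t : ℝ) : ℂ)) ∈ mixedPolynomials l := by
  have e : (fun z : Fin l → ℂ => ((inner ℝ (WithLp.toLp 2 z) t : ℝ) : ℂ))
      = ∑ i, ((starRingEnd ℂ (t i) / 2) • mixedMonomial (Pi.single i 1) 0
        + (t i / 2) • mixedMonomial 0 (Pi.single i 1)) := by
    funext z
    rw [PiLp.inner_apply, Complex.ofReal_sum, Finset.sum_apply]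
    refine Finset.sum_congr rfl fun i _ => ?_
    simp only [Pi.add_apply, Pi.smul_apply, mixedMonomial_single_left,
      mixedMonomial_single_right, smul_eq_mul, Complex.inner]
    rw [Complex.re_eq_add_conj]
    simp
    ring
  rw [e]
  exact Submodule.sum_mem _ fun i _ => Submodule.add_mem _
    (Submodule.smul_mem _ _ (mixedMonomial_mem _ _))
    (Submodule.smul_mem _ _ (mixedMonomial_mem _ _))

lemma integrable_and_tendsto_of_mem_mixedPolynomials {X : ∀ n, Ω n → Fin l → ℂ}
    {Y : Ω' → Fin l → ℂ}
    (hXi : ∀ a b n, Integrable (fun ω => mixedMonomial a b (X n ω)) (P n))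
    (hYi : ∀ a b, Integrable (fun ω => mixedMonomial a b (Y ω)) P')
    (hlim : ∀ a b, Tendsto (fun n => ∫ ω, mixedMonomial a b (X n ω) ∂(P n)) atTop
      (𝓝 (∫ ω, mixedMonomial a b (Y ω) ∂P')))
    {f : (Fin l → ℂ) → ℂ} (hf : f ∈ mixedPolynomials l) :
    (∀ n, Integrable (fun ω => f (X n ω)) (P n)) ∧ Integrable (fun ω => f (Y ω)) P' ∧
      Tendsto (fun n => ∫ ω, f (X n ω) ∂(P n)) atTop (𝓝 (∫ ω, f (Y ω) ∂P')) := by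
  induction hf using Submodule.span_induction with
  | mem f hf =>
    obtain ⟨p, rfl⟩ := hf
    exact ⟨hXi p.1 p.2, hYi p.1 p.2, hlim p.1 p.2⟩
  | zero => simp
  | add f g _ _ hf hg =>
    obtain ⟨hf1, hf2, hf3⟩ := hf
    obtain ⟨hg1, hg2, hg3⟩ := hg
    refine ⟨fun n => (hf1 n).add (hg1 n), hf2.add hg2, ?_⟩
    simp only [Pi.add_apply]
    simp_rw [fun n => integral_add (hf1 n) (hg1 n)]
    rw [integral_add hf2 hg2]
    exact hf3.add hg3
  | smul c f _ hf =>
    obtain ⟨hf1, hf2, hf3⟩ := hf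
    refine ⟨fun n => (hf1 n).smul c, hf2.smul c, ?_⟩
    simp only [Pi.smul_apply, integral_smul]
    exact hf3.const_smul c

/-- The **method of moments** for complex random vectors whose limit has exponential moments. -/
theorem tendstoInDistribution_of_mixedMonomial [∀ n, IsProbabilityMeasure (P n)]
    [IsProbabilityMeasure P'] {X : ∀ n, Ω n → Fin l → ℂ} {Y : Ω' → Fin l → ℂ}
    (hX : ∀ n, AEMeasurable (X n) (P n)) (hY : AEMeasurable Y P')
    (hexp : ∀ c : ℝ, 0 ≤ c → Integrable (fun ω => Real.exp (c * ‖Y ω‖)) P')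
    (hXi : ∀ a b n, Integrable (fun ω => mixedMonomial a b (X n ω)) (P n))
    (hYi : ∀ a b, Integrable (fun ω => mixedMonomial a b (Y ω)) P')
    (hlim : ∀ a b, Tendsto (fun n => ∫ ω, mixedMonomial a b (X n ω) ∂(P n)) atTop
      (𝓝 (∫ ω, mixedMonomial a b (Y ω) ∂P'))) :
    TendstoInDistribution X atTop Y P P' := by
  have hm : Measurable (WithLp.toLp 2 : (Fin l → ℂ) → EuclideanSpace ℂ (Fin l)) :=
    (PiLp.continuous_toLp 2 _).measurable
  have hX' : ∀ n, AEMeasurable (fun ω => (WithLp.toLp 2 (X n ω) : EuclideanSpace ℂ (Fin l)))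
      (P n) := fun n => hm.comp_aemeasurable (hX n)
  have hY' : AEMeasurable (fun ω => (WithLp.toLp 2 (Y ω) : EuclideanSpace ℂ (Fin l))) P' :=
    hm.comp_aemeasurable hY
  -- Characteristic functions require an inner product, so the argument runs in the Euclidean space
  -- and is carried back by a continuous map.
  have key : TendstoInDistribution
      (fun n ω => (WithLp.toLp 2 (X n ω) : EuclideanSpace ℂ (Fin l))) atTop
      (fun ω => (WithLp.toLp 2 (Y ω) : EuclideanSpace ℂ (Fin l))) P P' := by
    refine ⟨hX', hY', ?_⟩
    refine ProbabilityMeasure.tendsto_of_tendsto_charFun fun t => ?_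
    have hc : Continuous fun x : EuclideanSpace ℂ (Fin l) =>
        Complex.exp ((inner ℝ x t : ℝ) * Complex.I) := by fun_prop
    simp only [charFun_apply, ProbabilityMeasure.coe_mk]
    rw [integral_map hY' hc.aestronglyMeasurable]
    simp_rw [fun n => integral_map (hX' n) hc.aestronglyMeasurable]
    have hp : ∀ m, (fun z : Fin l → ℂ => ((inner ℝ (WithLp.toLp 2 z) t : ℝ) : ℂ) ^ m)
        ∈ mixedPolynomials l := fun m =>
      pow_mem_mixedPolynomials (inner_mem_mixedPolynomials t) m
    have hp' := fun m => integrable_and_tendsto_of_mem_mixedPolynomials hXi hYi hlim (hp m)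
    have hi : Continuous fun x : EuclideanSpace ℂ (Fin l) => (inner ℝ x t : ℝ) := by fun_prop
    refine tendsto_integral_cexp_of_moments
      (fun n => hi.comp_aestronglyMeasurable (hX' n).aestronglyMeasurable)
      (hi.comp_aestronglyMeasurable hY'.aestronglyMeasurable) ?_
      (fun m => (hp' m).1) (fun m => (hp' m).2.1) (fun m => (hp' m).2.2)
    let L : (Fin l → ℂ) →L[ℝ] ℝ := LinearMap.toContinuousLinearMap
      { toFun := fun z => inner ℝ (WithLp.toLp 2 z : EuclideanSpace ℂ (Fin l)) t
        map_add' := fun z w => by rw [WithLp.toLp_add, inner_add_left]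
        map_smul' := fun c z => by rw [WithLp.toLp_smul, real_inner_smul_left]; rfl }
    refine (hexp ‖L‖ (norm_nonneg _)).mono' ?_ (Eventually.of_forall fun ω => ?_)
    · exact (Real.continuous_exp.comp (continuous_abs.comp hi)).comp_aestronglyMeasurable
        hY'.aestronglyMeasurable
    · rw [Real.norm_eq_abs, Real.abs_exp, Real.exp_le_exp]
      exact L.le_opNorm (Y ω)
  exact key.continuous_comp (PiLp.continuous_ofLp 2 _)

end Vector

end MethodOfMoments

/-! ### Moments of complex Gaussian vectors -/

section Gaussian

variable {Ω : Type*} [MeasurableSpace Ω] {P : Measure Ω}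

lemma gaussianPDFReal_mul_gaussianPDFReal (x y : ℝ) :
    gaussianPDFReal 0 (1 / 2) x * gaussianPDFReal 0 (1 / 2) y
      = Real.pi⁻¹ * Real.exp (-(x ^ 2 + y ^ 2)) := by
  have h : (2 * Real.pi * ((1 / 2 : ℝ≥0) : ℝ)) = Real.pi := by push_cast; ring
  simp only [gaussianPDFReal_def, h]
  have h2 : (√Real.pi)⁻¹ * (√Real.pi)⁻¹ = Real.pi⁻¹ := by
    rw [← mul_inv, Real.mul_self_sqrt Real.pi_pos.le]
  rw [mul_mul_mul_comm, h2, ← Real.exp_add]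
  congr 2
  push_cast
  ring

lemma IsStdComplexNormal.aemeasurable {ξ : Ω → ℂ} (h : IsStdComplexNormal ξ P) :
    AEMeasurable ξ P := by
  have := (Complex.measurableEquivRealProd.symm.measurable.comp_aemeasurable
    (h.law_re.aemeasurable.prodMk h.law_im.aemeasurable))
  exact this

/-- A standard complex normal variable has density `π⁻¹ exp (-‖z‖ ^ 2)`. -/
lemma IsStdComplexNormal.integral_comp [IsProbabilityMeasure P] {ξ : Ω → ℂ}
    (h : IsStdComplexNormal ξ P) {f : ℂ → ℂ} (hf : Continuous f) :
    ∫ ω, f (ξ ω) ∂P = ∫ z : ℂ, (Real.pi⁻¹ * Real.exp (-‖z‖ ^ 2)) • f z := by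
  have hlaw := (indepFun_iff_map_prod_eq_prod_map_map h.law_re.aemeasurable
    h.law_im.aemeasurable).1 h.indep
  have hv : (1 / 2 : ℝ≥0) ≠ 0 := by norm_num
  rw [h.law_re.map_eq, h.law_im.map_eq, gaussianReal_of_var_ne_zero _ hv,
    prod_withDensity (measurable_gaussianPDF _ _) (measurable_gaussianPDF _ _)] at hlaw
  have hg : Continuous fun p : ℝ × ℝ => f (Complex.equivRealProdCLM.symm p) :=
    hf.comp Complex.equivRealProdCLM.symm.continuous
  have h1 : ∫ ω, f (ξ ω) ∂P
      = ∫ p : ℝ × ℝ, f (Complex.equivRealProdCLM.symm p)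
        ∂(P.map fun ω => ((ξ ω).re, (ξ ω).im)) := by
    rw [integral_map (h.law_re.aemeasurable.prodMk h.law_im.aemeasurable)
      hg.aestronglyMeasurable]
    rfl
  rw [h1, hlaw, integral_withDensity_eq_integral_toReal_smul (by fun_prop)
    (Eventually.of_forall fun p => ENNReal.mul_lt_top gaussianPDF_lt_top gaussianPDF_lt_top),
    ← Measure.volume_eq_prod, ← Complex.volume_preserving_equiv_real_prod.integral_comp']
  refine integral_congr_ae (Eventually.of_forall fun z => ?_)
  simp only [ENNReal.toReal_mul, toReal_gaussianPDF, gaussianPDFReal_mul_gaussianPDFReal,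
    Complex.measurableEquivRealProd_apply]
  rw [← Complex.normSq_eq_norm_sq, Complex.normSq_apply, sq, sq]
  rfl

/-- The mixed moments of a standard complex normal variable. -/
lemma IsStdComplexNormal.integral_pow_mul_conj_pow [IsProbabilityMeasure P] {ξ : Ω → ℂ}
    (h : IsStdComplexNormal ξ P) (a b : ℕ) :
    ∫ ω, ξ ω ^ a * (starRingEnd ℂ) (ξ ω) ^ b ∂P = if a = b then (a.factorial : ℂ) else 0 := by
  rw [h.integral_comp (f := fun z => z ^ a * (starRingEnd ℂ) z ^ b) (by fun_prop)]
  split_ifs with hab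
  · subst hab
    -- On the diagonal the integrand is radial, and its integral is a multiple of `Γ(a + 1) = a!`.
    have h1 := Complex.integral_rpow_mul_exp_neg_rpow (p := 2) (q := 2 * a) one_le_two
      (by have : (0 : ℝ) ≤ a := Nat.cast_nonneg a; linarith)
    have h2 : ((2 * a + 2) / 2 : ℝ) = a + 1 := by ring
    rw [h2, Real.Gamma_nat_eq_factorial] at h1
    have h3 : ∀ z : ℂ, (Real.pi⁻¹ * Real.exp (-‖z‖ ^ 2)) • (z ^ a * (starRingEnd ℂ) z ^ a)
        = ((Real.pi⁻¹ * (‖z‖ ^ (2 * a : ℝ) * Real.exp (-‖z‖ ^ (2 : ℝ))) : ℝ) : ℂ) := by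
      intro z
      rw [← mul_pow, Complex.mul_conj', Complex.real_smul, show (2 * a : ℝ) = (2 * a : ℕ) by
        push_cast; ring, Real.rpow_natCast, Real.rpow_two, pow_mul]
      push_cast
      ring
    simp_rw [h3]
    rw [integral_complex_ofReal, integral_const_mul, h1]
    have := Real.pi_ne_zero
    rw [show Real.pi⁻¹ * (2 * Real.pi / 2 * (a.factorial : ℝ)) = a.factorial by field_simp]
    simp
  -- Rotation by the angle π/(a - b) preserves the Gaussian density and multiplies the monomial by
  -- -1, so the integral equals its own negative.
  · set c : Circle := Circle.exp (Real.pi / ((a : ℝ) - b))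
    have hab' : (a : ℝ) - b ≠ 0 := sub_ne_zero.2 (by exact_mod_cast hab)
    have hc : (c : ℂ) ^ a * (starRingEnd ℂ) (c : ℂ) ^ b = -1 := by
      rw [Circle.coe_exp, ← Complex.exp_conj, ← Complex.exp_nat_mul, ← Complex.exp_nat_mul,
        ← Complex.exp_add, ← Complex.exp_pi_mul_I]
      congr 1
      have : (a : ℂ) - b ≠ 0 := by exact_mod_cast hab'
      simp only [map_mul, Complex.conj_ofReal, Complex.conj_I]
      push_cast
      field_simp
      ring
    have hr := (rotation c).measurePreserving.integral_comp
      (rotation c).toHomeomorph.measurableEmbedding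
      (fun z : ℂ => (Real.pi⁻¹ * Real.exp (-‖z‖ ^ 2)) • (z ^ a * (starRingEnd ℂ) z ^ b))
    have h3 : ∀ z : ℂ, (Real.pi⁻¹ * Real.exp (-‖rotation c z‖ ^ 2)) •
        (rotation c z ^ a * (starRingEnd ℂ) (rotation c z) ^ b)
        = -((Real.pi⁻¹ * Real.exp (-‖z‖ ^ 2)) • (z ^ a * (starRingEnd ℂ) z ^ b)) := by
      intro z
      rw [LinearIsometryEquiv.norm_map, ← smul_neg, rotation_apply, map_mul, mul_pow, mul_pow,
        mul_mul_mul_comm, hc, neg_one_mul]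
    simp_rw [h3] at hr
    rw [integral_neg] at hr
    exact self_eq_neg.1 hr.symm

lemma integrable_exp_mul_abs_of_hasLaw {x : Ω → ℝ} {v : ℝ≥0}
    (hx : HasLaw x (gaussianReal 0 v) P) (c : ℝ) :
    Integrable (fun ω => Real.exp (c * |x ω|)) P := by
  have h : ∀ t : ℝ, Integrable (fun ω => Real.exp (t * x ω)) P := fun t => by
    have := integrable_exp_mul_gaussianReal (μ := 0) (v := v) t
    rw [← hx.map_eq] at this
    exact this.comp_aemeasurable hx.aemeasurable
  refine ((h c).add (h (-c))).mono' ?_ (Eventually.of_forall fun ω => ?_)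
  · have hcont : Continuous fun r : ℝ => Real.exp (c * |r|) := by fun_prop
    exact hcont.comp_aestronglyMeasurable hx.aemeasurable.aestronglyMeasurable
  · rw [Real.norm_eq_abs, Real.abs_exp, Pi.add_apply]
    rcases abs_cases (x ω) with h | h
    · rw [h.1]; linarith [Real.exp_pos (-c * x ω)]
    · rw [h.1, mul_neg, ← neg_mul]; linarith [Real.exp_pos (c * x ω)]

/-- Since |ξ| is at most twice the larger of |Re ξ| and |Im ξ|, real exponential moments with
constant 2c suffice. -/
lemma IsStdComplexNormal.integrable_exp {ξ : Ω → ℂ} (h : IsStdComplexNormal ξ P) {c : ℝ}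
    (hc : 0 ≤ c) : Integrable (fun ω => Real.exp (c * ‖ξ ω‖)) P := by
  refine ((integrable_exp_mul_abs_of_hasLaw h.law_re (2 * c)).add
    (integrable_exp_mul_abs_of_hasLaw h.law_im (2 * c))).mono' ?_
    (Eventually.of_forall fun ω => ?_)
  · have hcont : Continuous fun r : ℂ => Real.exp (c * ‖r‖) := by fun_prop
    exact hcont.comp_aestronglyMeasurable h.aemeasurable.aestronglyMeasurable
  · rw [Real.norm_eq_abs, Real.abs_exp, Pi.add_apply]
    have h1 := mul_le_mul_of_nonneg_left (Complex.norm_le_abs_re_add_abs_im (ξ ω)) hc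
    rcases le_total |(ξ ω).re| |(ξ ω).im| with h2 | h2
    · have : Real.exp (c * ‖ξ ω‖) ≤ Real.exp (2 * c * |(ξ ω).im|) :=
        Real.exp_le_exp.2 (by nlinarith)
      linarith [Real.exp_pos (2 * c * |(ξ ω).re|)]
    · have : Real.exp (c * ‖ξ ω‖) ≤ Real.exp (2 * c * |(ξ ω).re|) :=
        Real.exp_le_exp.2 (by nlinarith)
      linarith [Real.exp_pos (2 * c * |(ξ ω).im|)]

variable {l : ℕ}

lemma integrable_exp_mul_norm_pi [IsFiniteMeasure P] {Y : Ω → Fin l → ℂ}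
    (hY : ∀ i, AEMeasurable (fun ω => Y ω i) P) {c : ℝ} (hc : 0 ≤ c)
    (hexp : ∀ i, Integrable (fun ω => Real.exp (c * ‖Y ω i‖)) P) :
    Integrable (fun ω => Real.exp (c * ‖Y ω‖)) P := by
  refine ((integrable_const (1 : ℝ)).add (integrable_finsetSum Finset.univ
    fun i _ => hexp i)).mono' ?_ (Eventually.of_forall fun ω => ?_)
  · have hcont : Continuous fun r : Fin l → ℂ => Real.exp (c * ‖r‖) := by fun_prop
    exact hcont.comp_aestronglyMeasurable (aemeasurable_pi_lambda _ hY).aestronglyMeasurable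
  · rw [Real.norm_eq_abs, Real.abs_exp, Pi.add_apply]
    have hnn : ∀ i ∈ Finset.univ, 0 ≤ Real.exp (c * ‖Y ω i‖) := fun i _ => (Real.exp_pos _).le
    have hpos : 0 < 1 + ∑ i, Real.exp (c * ‖Y ω i‖) := by
      linarith [Finset.sum_nonneg hnn]
    -- Taking logarithms allows the sup norm to be bounded coordinatewise; the added 1 keeps the
    -- logarithm nonnegative even when l = 0.
    rw [← Real.le_log_iff_exp_le hpos]
    have hlog : 0 ≤ Real.log (1 + ∑ i, Real.exp (c * ‖Y ω i‖)) :=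
      Real.log_nonneg (by linarith [Finset.sum_nonneg hnn])
    have : ‖c • Y ω‖ ≤ Real.log (1 + ∑ i, Real.exp (c * ‖Y ω i‖)) := by
      refine (pi_norm_le_iff_of_nonneg hlog).2 fun i => ?_
      rw [Pi.smul_apply, norm_smul, Real.norm_of_nonneg hc, Real.le_log_iff_exp_le hpos]
      linarith [Finset.single_le_sum hnn (Finset.mem_univ i)]
    rwa [norm_smul, Real.norm_of_nonneg hc] at this

lemma continuous_mixedMonomial (a b : Fin l → ℕ) : Continuous (mixedMonomial a b) := by
  unfold mixedMonomial; fun_prop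

lemma norm_mixedMonomial_le (a b : Fin l → ℕ) (z : Fin l → ℂ) :
    ‖mixedMonomial a b z‖ ≤ ‖z‖ ^ ∑ i, (a i + b i) := by
  rw [mixedMonomial, norm_prod, ← Finset.prod_pow_eq_pow_sum]
  refine Finset.prod_le_prod (fun i _ => norm_nonneg _) fun i _ => ?_
  rw [norm_mul, norm_pow, norm_pow, RCLike.norm_conj, ← pow_add]
  exact pow_le_pow_left₀ (norm_nonneg _) (norm_le_pi_norm z i) _

/-- A monomial of total degree m is at most `‖Y‖^m ≤ m! exp ‖Y‖`. -/
lemma integrable_mixedMonomial_of_exp {Y : Ω → Fin l → ℂ} (hY : AEMeasurable Y P)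
    (hexp : Integrable (fun ω => Real.exp ‖Y ω‖) P) (a b : Fin l → ℕ) :
    Integrable (fun ω => mixedMonomial a b (Y ω)) P := by
  set m := ∑ i, (a i + b i)
  refine (hexp.const_mul (m.factorial : ℝ)).mono'
    ((continuous_mixedMonomial a b).comp_aestronglyMeasurable hY.aestronglyMeasurable)
    (Eventually.of_forall fun ω => (norm_mixedMonomial_le a b (Y ω)).trans ?_)
  have := Real.pow_div_factorial_le_exp ‖Y ω‖ (norm_nonneg _) m
  rwa [div_le_iff₀' (by positivity)] at this

/-- The mixed moments of the vector `(√1 Z₁, …, √l Z_l)`. -/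
lemma integral_mixedMonomial_sqrt_mul [IsProbabilityMeasure P] {Z : Fin l → Ω → ℂ}
    (hZ : ∀ i, IsStdComplexNormal (Z i) P) (hZind : iIndepFun Z P) (a b : Fin l → ℕ) :
    ∫ ω, mixedMonomial a b (fun i => (Real.sqrt ((i.val : ℝ) + 1) : ℂ) * Z i ω) ∂P =
      ∏ i, (if a i = b i then ((a i).factorial : ℂ) * ((i.val : ℂ) + 1) ^ a i else 0) := by
  have h := hZind.integral_fun_prod_comp (f := fun i z =>
    ((Real.sqrt ((i.val : ℝ) + 1) : ℂ) * z) ^ a i *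
      (starRingEnd ℂ) ((Real.sqrt ((i.val : ℝ) + 1) : ℂ) * z) ^ b i)
    (fun i => (hZ i).aemeasurable) (fun i => by fun_prop)
  refine h.trans (Finset.prod_congr rfl fun i _ => ?_)
  have e : ∀ z : ℂ, ((Real.sqrt ((i.val : ℝ) + 1) : ℂ) * z) ^ a i *
      (starRingEnd ℂ) ((Real.sqrt ((i.val : ℝ) + 1) : ℂ) * z) ^ b i
      = (Real.sqrt ((i.val : ℝ) + 1) : ℂ) ^ (a i + b i) *
        (z ^ a i * (starRingEnd ℂ) z ^ b i) := by
    intro z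
    rw [map_mul, Complex.conj_ofReal]
    ring
  simp_rw [e]
  rw [integral_const_mul, (hZ i).integral_pow_mul_conj_pow]
  split_ifs with hab
  · rw [← hab, ← two_mul, pow_mul, ← Complex.ofReal_pow, Real.sq_sqrt (by positivity)]
    push_cast
    ring
  · simp

end Gaussian

/-- Convergence in distribution to a vector with independent coordinates implies asymptotic
independence. -/
lemma asymptoticallyIndependent_of_tendstoInDistribution {l : ℕ} {Ω : ℕ → Type*}
    [∀ n, MeasurableSpace (Ω n)] {P : ∀ n, Measure (Ω n)} [∀ n, IsProbabilityMeasure (P n)]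
    {Ω' : Type*} [MeasurableSpace Ω'] {P' : Measure Ω'} [IsProbabilityMeasure P']
    {X : ∀ n, Ω n → Fin l → ℂ} {Y : Ω' → Fin l → ℂ}
    (h : TendstoInDistribution X atTop Y P P') (hY : iIndepFun (fun i ω => Y ω i) P') :
    AsymptoticallyIndependent P X := by
  intro f
  have ht : ∀ g : (Fin l → ℂ) →ᵇ ℝ, Tendsto (fun n => ∫ ω, g (X n ω) ∂(P n)) atTop
      (𝓝 (∫ ω, g (Y ω) ∂P')) := by
    intro g
    have := ProbabilityMeasure.tendsto_iff_forall_integral_tendsto.1 h.tendsto g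
    simp only [ProbabilityMeasure.coe_mk] at this
    rw [integral_map h.aemeasurable_limit g.continuous.aestronglyMeasurable] at this
    simp_rw [fun n => integral_map (h.forall_aemeasurable n)
      g.continuous.aestronglyMeasurable] at this
    exact this
  -- The product of the `f i` and each single `f i` are bounded continuous on the whole vector, so
  -- both expressions converge; independence of the limit equates their limits.
  have h1 := ht (∏ i, (f i).compContinuous ⟨fun z => z i, continuous_apply i⟩)
  have h2 := fun i => ht ((f i).compContinuous ⟨fun z => z i, continuous_apply i⟩)
  have hmeas : ∀ i, AEMeasurable (fun ω => Y ω i) P' := fun i =>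
    (measurable_pi_apply i).comp_aemeasurable h.aemeasurable_limit
  have h3 := hY.integral_fun_prod_comp (f := fun i z => f i z) hmeas
    (fun i => (f i).continuous.aestronglyMeasurable)
  have h4 := h1.sub (tendsto_finsetProd Finset.univ fun i _ => h2 i)
  simp only [BoundedContinuousFunction.prod_apply, BoundedContinuousFunction.compContinuous_apply,
    ContinuousMap.coe_mk] at h4
  rw [h3, sub_self] at h4
  exact h4

end HaarUnitary

end

/-- `powTrace` is a continuous function on the unitary group. -/
lemma HaarUnitary.continuous_powTrace {n : ℕ} (k : ℕ) :
    Continuous (HaarUnitary.powTrace k : Matrix.unitaryGroup (Fin n) ℂ → ℂ) := by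
  rw [← funext (HaarUnitary.ptr_natCast k)]
  exact HaarUnitary.continuous_ptr _

/-! ### Assembly: transfer from Haar measure to the variables `U n` -/

theorem mainTheorem3
    {Ω : ℕ → Type*} [∀ n, MeasurableSpace (Ω n)]
    (P : ∀ n, Measure (Ω n)) [∀ n, IsProbabilityMeasure (P n)]
    (U : ∀ n, Ω n → Matrix.unitaryGroup (Fin n) ℂ)
    (hU : ∀ n, HasLaw (U n) (HaarUnitary.haarUnitaryMeasure n) (P n))
    (l : ℕ)
    {Ω' : Type*} [MeasurableSpace Ω'] (P' : Measure Ω') [IsProbabilityMeasure P']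
    (Z : Fin l → Ω' → ℂ)
    (hZ : ∀ i, HaarUnitary.IsStdComplexNormal (Z i) P')
    (hZind : iIndepFun Z P') :
    -- convergence of all joint moments, with the value of the limit
    (∀ a b : Fin l → ℕ,
      (∀ n, Integrable (fun ω => HaarUnitary.mixedMonomial a b
        (fun i => HaarUnitary.powTrace (i.val + 1) (U n ω))) (P n)) ∧
      Integrable (fun ω => HaarUnitary.mixedMonomial a b
        (fun i => (Real.sqrt ((i.val : ℝ) + 1) : ℂ) * Z i ω)) P' ∧
      Tendsto (fun n => ∫ ω, HaarUnitary.mixedMonomial a b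
          (fun i => HaarUnitary.powTrace (i.val + 1) (U n ω)) ∂(P n)) atTop
        (𝓝 (∫ ω, HaarUnitary.mixedMonomial a b
          (fun i => (Real.sqrt ((i.val : ℝ) + 1) : ℂ) * Z i ω) ∂P')) ∧
      (∫ ω, HaarUnitary.mixedMonomial a b
          (fun i => (Real.sqrt ((i.val : ℝ) + 1) : ℂ) * Z i ω) ∂P') =
        ∏ i, (if a i = b i then ((a i).factorial : ℂ) * ((i.val : ℂ) + 1) ^ a i else 0)) ∧
    -- joint convergence in distribution to a vector of independent complex Gaussians
    TendstoInDistribution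
      (fun n ω (i : Fin l) => HaarUnitary.powTrace (i.val + 1) (U n ω)) atTop
      (fun ω (i : Fin l) => (Real.sqrt ((i.val : ℝ) + 1) : ℂ) * Z i ω) P P' ∧
    iIndepFun (fun (i : Fin l) ω => (Real.sqrt ((i.val : ℝ) + 1) : ℂ) * Z i ω) P' ∧
    -- asymptotic independence of the traces of different powers
    HaarUnitary.AsymptoticallyIndependent P
      (fun n ω (i : Fin l) => HaarUnitary.powTrace (i.val + 1) (U n ω)) := by
  have hUm : ∀ n, AEMeasurable (fun ω (i : Fin l) => HaarUnitary.powTrace (i.val + 1) (U n ω))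
      (P n) := fun n => (continuous_pi fun i : Fin l =>
        HaarUnitary.continuous_powTrace (i.val + 1)).measurable.comp_aemeasurable (hU n).aemeasurable
  have hZm : AEMeasurable (fun ω (i : Fin l) => (Real.sqrt ((i.val : ℝ) + 1) : ℂ) * Z i ω) P' :=
    aemeasurable_pi_lambda _ fun i => (hZ i).aemeasurable.const_mul _
  have hexp : ∀ c : ℝ, 0 ≤ c → Integrable (fun ω =>
      Real.exp (c * ‖fun i : Fin l => (Real.sqrt ((i.val : ℝ) + 1) : ℂ) * Z i ω‖)) P' := by
    intro c hc
    refine HaarUnitary.integrable_exp_mul_norm_pi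
      (fun i => (hZ i).aemeasurable.const_mul _) hc fun i => ?_
    have := (hZ i).integrable_exp (mul_nonneg hc (Real.sqrt_nonneg ((i.val : ℝ) + 1)))
    refine this.congr (Eventually.of_forall fun ω => ?_)
    simp only [norm_mul, Complex.norm_real, Real.norm_of_nonneg (Real.sqrt_nonneg _), mul_assoc]
  have hUi : ∀ (a b : Fin l → ℕ) n, Integrable (fun ω => HaarUnitary.mixedMonomial a b
      (fun i => HaarUnitary.powTrace (i.val + 1) (U n ω))) (P n) := by
    intro a b n
    have h := HaarUnitary.integrable_of_continuous
      (HaarUnitary.continuous_ptrProd (n := n) (HaarUnitary.signedExponents a b))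
    rw [← (hU n).map_eq] at h
    refine (h.comp_aemeasurable (hU n).aemeasurable).congr (Eventually.of_forall fun ω => ?_)
    exact HaarUnitary.ptrProd_signedExponents a b (U n ω)
  have hZi : ∀ a b : Fin l → ℕ, Integrable (fun ω => HaarUnitary.mixedMonomial a b
      (fun i => (Real.sqrt ((i.val : ℝ) + 1) : ℂ) * Z i ω)) P' := fun a b =>
    HaarUnitary.integrable_mixedMonomial_of_exp hZm (by simpa using hexp 1 zero_le_one) a b
  have hval := HaarUnitary.integral_mixedMonomial_sqrt_mul hZ hZind
  have hlim : ∀ a b : Fin l → ℕ, Tendsto (fun n => ∫ ω, HaarUnitary.mixedMonomial a b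
      (fun i => HaarUnitary.powTrace (i.val + 1) (U n ω)) ∂(P n)) atTop
      (𝓝 (∫ ω, HaarUnitary.mixedMonomial a b
        (fun i => (Real.sqrt ((i.val : ℝ) + 1) : ℂ) * Z i ω) ∂P')) := by
    intro a b
    rw [hval]
    refine (HaarUnitary.tendsto_integral_signedExponents a b).congr fun n => ?_
    rw [← (hU n).integral_comp
      (HaarUnitary.continuous_ptrProd (HaarUnitary.signedExponents a b)).aestronglyMeasurable]
    simp only [Function.comp_def, HaarUnitary.ptrProd_signedExponents]
  have hdist := HaarUnitary.tendstoInDistribution_of_mixedMonomial hUm hZm hexp hUi hZi hlim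
  have hind : iIndepFun (fun (i : Fin l) ω => (Real.sqrt ((i.val : ℝ) + 1) : ℂ) * Z i ω) P' :=
    hZind.comp (fun i z => (Real.sqrt ((i.val : ℝ) + 1) : ℂ) * z) fun i =>
      measurable_const_mul _
  exact ⟨fun a b => ⟨hUi a b, hZi a b, hlim a b, hval a b⟩, hdist, hind,
    HaarUnitary.asymptoticallyIndependent_of_tendstoInDistribution hdist hind⟩
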